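/- **Conventions.** Let $\mathbf B_n$ be the braid group on $n$ strands with Artin generators $\sigma_1,\dots,\sigma_{n-1}$ (trivial for $n=0,1$), and let $\sigma\natural\sigma'\in\mathbf B_{m+n}$ be the juxtaposition of $\sigma\in\mathbf B_m$ and $\sigma'\in\mathbf B_n$, so that $\sigma_i\natural id_n=\sigma_i$ and $id_m\natural\sigma_i=\sigma_{m+i}$. The braiding is $b_{n,m}=(\sigma_m\circ\cdots\circ\sigma_1)\circ\cdots\circ(\sigma_{n+m-2}\circ\cdots\circ\sigma_{n-1})\circ(\sigma_{n+m-1}\circ\cdots\circ\sigma_n)\in\mathbf B_{n+m}$. Let $\mathfrak U\boldsymbol\beta$ be the category whose objects are the natural numbers and in which a morphism $n\to n'$ exists only if $n\le n'$ and is then a class $[n'-n,f]$ of braids $f\in\mathbf B_{n'}$ modulo $f\sim f\circ(g\natural id_n)$ for $g\in\mathbf B_{n'-n}$; the composition is $[n''-n',g]\circ[n'-n,f]=[n''-n,\,g\circ(id_{n''-n'}\natural f)]$. We write $\sigma$ for the endomorphism $[0,\sigma]$ of $n$. For each object $x$ there is the functor $x\natural-:\mathfrak U\boldsymbol\beta\to\mathfrak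 U\boldsymbol\beta$ with $n\mapsto x+n$ and $id_x\natural[n'-n,f]=[n'-n,\,(id_x\natural f)\circ(b_{x,n'-n}^{-1}\natural id_n)]$. Let $\mathbb K$ be a commutative ring. For a functor $F:\mathfrak U\boldsymbol\beta\to\mathbb K\text{-}\mathfrak{Mod}$ put $\tau_x(F)=F(x\natural-)$, let $i_x:F\to\tau_x(F)$ be the natural transformation with components $F([x,id_{x+n}]):F(n)\to F(x+n)$, and let $\delta_x(F)$ be its cokernel. A functor is strong polynomial of degree at most $n$, for an integer $n<0$, if it is null; for $n\ge0$, $F$ is strong polynomial of degree at most $n$ if $\delta_x(F)$ is strong polynomial of degree at most $n-1$ for all objects $x$. The strong degree of $F$ is the smallest $d\in\mathbb N$ such that $F$ is strong polynomial of degree at most $d$. Let $\mathbf F_n$ be the free group on $n$ generators. For $n\le n'$ let $\iota_{\mathbf F_{n'-n}}*id_{\mathbf F_n}:\mathbf F_n\to\mathbf F_{n'}$ and $id_{\mathbf F_n}*\iota_{\mathbf F_{n'-n}}:\mathbf F_n\to\mathbf F_{n'}$ be the inclusions on the last, respectively the first, $n$ generators; for $g\in\mathbf F_n$ write $e_{\mathbf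 F_{n'-n}}*g$ for its image under the first. Let $\varsigma_n:\mathbf F_n\to\mathbf B_{1+n}$ and $a_n:\mathbf B_n\to Aut(\mathbf F_n)$, $n\in\mathbb N$, be group morphisms. The families are *coherent* if for all $n\le n'$, $g\in\mathbf F_n$, $\sigma\in\mathbf B_n$, $\sigma'\in\mathbf B_{n'-n}$: 1. $(id_1\natural[n'-n,id_{n'}])\circ\varsigma_n(g)=\varsigma_{n'}(e_{\mathbf F_{n'-n}}*g)\circ(id_1\natural[n'-n,id_{n'}])$ in $\mathfrak U\boldsymbol\beta$; 2. $(\iota_{\mathbf F_{n'-n}}*id_{\mathbf F_n})\circ a_n(\sigma)=a_{n'}(\sigma'\natural\sigma)\circ(\iota_{\mathbf F_{n'-n}}*id_{\mathbf F_n})$; 3. $(id_1\natural\sigma)\circ\varsigma_n(g)=\varsigma_n(a_n(\sigma)(g))\circ(id_1\natural\sigma)$ in $\mathbf B_{1+n}$. Coherent families are *reliable* if moreover, for all $n\le n'$ and $\sigma\in\mathbf B_n$: 4. $a_{1+n'}(b_{1,n'-n}^{-1}\natural id_n)\circ(\iota_{\mathbf F_{n'-n}}*id_{\mathbf F_{1+n}})\circ(id_{\mathbf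 F_1}*\iota_{\mathbf F_n})=id_{\mathbf F_1}*\iota_{\mathbf F_{n'}}$; 5. $a_{n'}(id_{n'-n}\natural\sigma)\circ(id_{\mathbf F_{n'-n}}*\iota_{\mathbf F_n})=id_{\mathbf F_{n'-n}}*\iota_{\mathbf F_n}$. Let $\mathcal I_{\mathbb K[\mathbf F_n]}$ be the augmentation ideal of $\mathbb K[\mathbf F_n]$. For coherent families, the Long-Moody functor $\mathbf{LM}$ sends $F$ to the functor with $\mathbf{LM}(F)(n)=\mathcal I_{\mathbb K[\mathbf F_n]}\otimes_{\mathbb K[\mathbf F_n]}F(1+n)$, where $\mathbf F_n$ acts on $F(1+n)$ through $\varsigma_n$, and with $\mathbf{LM}(F)([n'-n,\sigma])(i\otimes v)=a_{n'}(\sigma)\big((\iota_{\mathbf F_{n'-n}}*id_{\mathbf F_n})(i)\big)\otimes F(id_1\natural[n'-n,\sigma])(v)$; on natural transformations, $\mathbf{LM}(\eta)_n=id\otimes\eta_{1+n}$. **Statement.** Let $\{\varsigma_n\}$ and $\{a_n\}$ be coherent reliable families of morphisms. Let $d$ be a natural number and let $F:\mathfrak U\boldsymbol\beta\to\mathbb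 K\text{-}\mathfrak{Mod}$ be strong polynomial of degree at most $d$ such that $\tau_2(F)$ is not null and the strong degree of $\tau_2(F)$ is equal to $d$. Then $\mathbf{LM}(F)$ is strong polynomial of strong degree equal to $d+1$. -/

import Mathlib

open CategoryTheory CategoryTheory.Limits
open scoped TensorProduct

universe u

/-! ### Braid groups -/

/-- The relations of Artin's presentation; the generator `i : Fin (n - 1)` is `σ_{i+1}`. -/
def braidRels (n : ℕ) : Set (FreeGroup (Fin (n - 1))) :=
  {r | ∃ i j : Fin (n - 1),
    ((i : ℕ) + 1 = j ∧
      r = .of i * .of j * .of i * (.of j * .of i * .of j)⁻¹) ∨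
    ((i : ℕ) + 2 ≤ j ∧ r = .of i * .of j * (.of j * .of i)⁻¹)}

/-- The braid group on `n` strands (trivial for `n = 0, 1`). The product `σ * σ'` is the
composition `σ ∘ σ'`, read from right to left. -/
abbrev Braid (n : ℕ) : Type := PresentedGroup (braidRels n)

namespace Braid

/-- The Artin generator `σ_{i+1}` of the braid group on `n` strands
(with value `1` if there is no such generator). -/
def gen (n i : ℕ) : Braid n :=
  if h : i < n - 1 then PresentedGroup.of ⟨i, h⟩ else 1

theorem gen_comm (n : ℕ) {i j : ℕ} (h : i + 2 ≤ j) : gen n i * gen n j = gen n j * gen n i := by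
  unfold gen
  split_ifs with hi hj
  · have := PresentedGroup.one_of_mem (rels := braidRels n)
      (x := .of ⟨i, hi⟩ * .of ⟨j, hj⟩ * (.of ⟨j, hj⟩ * .of ⟨i, hi⟩)⁻¹)
      ⟨⟨i, hi⟩, ⟨j, hj⟩, Or.inr ⟨h, rfl⟩⟩
    rw [map_mul, map_inv, mul_inv_eq_one, map_mul, map_mul] at this
    exact this
  all_goals simp

theorem gen_braid (n : ℕ) {i : ℕ} (h : i + 1 < n - 1) :
    gen n i * gen n (i + 1) * gen n i = gen n (i + 1) * gen n i * gen n (i + 1) := by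
  have hi : i < n - 1 := by omega
  unfold gen
  rw [dif_pos h, dif_pos hi]
  have := PresentedGroup.one_of_mem (rels := braidRels n)
    (x := .of ⟨i, hi⟩ * .of ⟨i + 1, h⟩ * .of ⟨i, hi⟩ *
      (.of ⟨i + 1, h⟩ * .of ⟨i, hi⟩ * .of ⟨i + 1, h⟩)⁻¹)
    ⟨⟨i, hi⟩, ⟨i + 1, h⟩, Or.inl ⟨rfl, rfl⟩⟩
  rw [map_mul, map_inv, mul_inv_eq_one] at this
  simp only [map_mul] at this
  exact this

theorem of_eq_gen {n : ℕ} (i : Fin (n - 1)) :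
    (PresentedGroup.of i : Braid n) = gen n i := by
  unfold gen; rw [dif_pos i.2]

/-- The homomorphism `σ ↦ id_k ♮ σ ♮ id_{N - k - n}`, which places a braid on `n` strands on the
strands `k + 1, …, k + n` among `N` strands: it sends `σ_i` to `σ_{k+i}`. -/
def shift {n N : ℕ} (k : ℕ) (h : k + n ≤ N) : Braid n →* Braid N :=
  PresentedGroup.toGroup (f := fun i : Fin (n - 1) => gen N (k + i)) (by
    rintro r ⟨i, j, ⟨hij, rfl⟩ | ⟨hij, rfl⟩⟩
    · have := gen_braid N (i := k + i) (by have := j.2; omega)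
      simp only [map_mul, map_inv, FreeGroup.lift_apply_of, mul_inv_eq_one]
      rw [← hij]; simpa only [add_assoc] using this
    · have := gen_comm N (i := k + i) (j := k + j) (by omega)
      simpa only [map_mul, map_inv, FreeGroup.lift_apply_of, mul_inv_eq_one] using this)

theorem shift_gen {n N : ℕ} (k : ℕ) (h : k + n ≤ N) {i : ℕ} (hi : i < n - 1) :
    shift k h (gen n i) = gen N (k + i) := by
  conv_lhs => unfold gen
  rw [dif_pos hi]
  exact PresentedGroup.toGroup.of _

theorem shift_shift {n N P : ℕ} (k l : ℕ) (h : k + n ≤ N) (h' : l + N ≤ P) (f : Braid n) :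
    shift l h' (shift k h f) = shift (l + k) (by omega) f := by
  have : (shift l h').comp (shift k h) = shift (l + k) (by omega) := by
    apply PresentedGroup.ext
    intro i
    have hi := i.2
    rw [MonoidHom.comp_apply, of_eq_gen, shift_gen k h hi, shift_gen l h' (by omega),
      shift_gen _ _ hi, add_assoc]
  exact DFunLike.congr_fun this f

theorem shift_zero {n : ℕ} (h : 0 + n ≤ n) (f : Braid n) : shift 0 h f = f := by
  have : shift 0 h = MonoidHom.id (Braid n) := by
    apply PresentedGroup.ext
    intro i
    rw [MonoidHom.id_apply, of_eq_gen, shift_gen _ _ i.2, zero_add]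
  exact DFunLike.congr_fun this f

theorem shift_congr {n N k l : ℕ} (hkl : k = l) (h : k + n ≤ N) (h' : l + n ≤ N) (f : Braid n) :
    shift k h f = shift l h' f := by
  subst hkl; rfl

theorem shift_eq_self {n k : ℕ} (hk : k = 0) (h : k + n ≤ n) (f : Braid n) :
    shift k h f = f := by
  subst hk; exact shift_zero h f

/-- An element that commutes with the images of the generators commutes with the image of
each braid. -/
theorem commute_of_gen {n : ℕ} {G : Type*} [Group G] (φ : Braid n →* G) (x : G)
    (h : ∀ i < n - 1, Commute x (φ (gen n i))) (f : Braid n) : Commute x (φ f) := by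
  have hf : f ∈ (Subgroup.centralizer {x}).comap φ := by
    refine PresentedGroup.generated_by (braidRels n) _ (fun i => ?_) f
    rw [Subgroup.mem_comap, Subgroup.mem_centralizer_singleton_iff, of_eq_gen]
    exact (h i i.2).eq.symm
  rw [Subgroup.mem_comap, Subgroup.mem_centralizer_singleton_iff] at hf
  exact hf.symm

theorem shift_commute {m n N k l : ℕ} (hk : k + m ≤ N) (hl : l + n ≤ N) (hkl : k + m ≤ l)
    (f : Braid m) (g : Braid n) : Commute (shift k hk f) (shift l hl g) := by
  refine commute_of_gen _ _ (fun j hj => ?_) g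
  refine (commute_of_gen _ _ (fun i hi => ?_) f).symm
  rw [shift_gen _ _ hi, shift_gen _ _ hj]
  exact (gen_comm N (by omega)).symm

/-- `run N j m = σ_{j+m} ∘ ⋯ ∘ σ_{j+2} ∘ σ_{j+1}`. -/
def run (N j : ℕ) : ℕ → Braid N
  | 0 => 1
  | m + 1 => gen N (j + m) * run N j m

/-- `crossing N o m n` is the braid
`(σ_{o+m} ∘ ⋯ ∘ σ_{o+1}) ∘ ⋯ ∘ (σ_{o+n+m-1} ∘ ⋯ ∘ σ_{o+n})` with `n` blocks of length `m`. -/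
def crossing (N o m : ℕ) : ℕ → Braid N
  | 0 => 1
  | n + 1 => crossing N o m n * run N (o + n) m

/-- The braiding `b_{n,m} : n ♮ m → m ♮ n`,
`(σ_m ∘ ⋯ ∘ σ_1) ∘ ⋯ ∘ (σ_{n+m-2} ∘ ⋯ ∘ σ_{n-1}) ∘ (σ_{n+m-1} ∘ ⋯ ∘ σ_n)`. -/
def braiding (n m : ℕ) : Braid (n + m) := crossing (n + m) 0 m n

theorem shift_run {n N k : ℕ} (h : k + n ≤ N) (j m : ℕ) (hm : j + m + 1 ≤ n) :
    shift k h (run n j m) = run N (k + j) m := by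
  induction m with
  | zero => exact map_one _
  | succ m ih =>
    rw [run, run, map_mul, ih (by omega), shift_gen _ _ (by omega), add_assoc]

theorem shift_crossing {n N k : ℕ} (h : k + n ≤ N) (o m p : ℕ) (hm : o + p + m ≤ n) :
    shift k h (crossing n o m p) = crossing N (k + o) m p := by
  induction p with
  | zero => exact map_one _
  | succ p ih =>
    rw [crossing, crossing, map_mul, ih (by omega), shift_run _ _ _ (by omega), add_assoc]

theorem commute_run (N j m i : ℕ) (h : j + m + 1 ≤ i ∨ i + 2 ≤ j) :
    Commute (gen N i) (run N j m) := by
  induction m with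
  | zero => exact Commute.one_right _
  | succ m ih =>
    rw [run]
    refine Commute.mul_right ?_ (ih (by omega))
    rcases h with h | h
    · exact (gen_comm N (by omega)).symm
    · exact gen_comm N (by omega)

theorem commute_crossing (N o m n i : ℕ) (h : o + n + m ≤ i) :
    Commute (gen N i) (crossing N o m n) := by
  induction n with
  | zero => exact Commute.one_right _
  | succ n ih =>
    rw [crossing]
    exact Commute.mul_right (ih (by omega)) (commute_run N _ _ _ (Or.inl (by omega)))

theorem crossing_commute_run (N o m n j k : ℕ) (h : o + n + m ≤ j) :
    Commute (run N j k) (crossing N o m n) := by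
  induction k with
  | zero => exact Commute.one_left _
  | succ k ih =>
    rw [run]
    exact Commute.mul_left (commute_crossing _ _ _ _ _ (by omega)) ih

theorem crossing_zero (N o n : ℕ) : crossing N o 0 n = 1 := by
  induction n with
  | zero => rfl
  | succ n ih => rw [crossing, ih, run, mul_one]

theorem run_mul_gen (N j m i : ℕ) (hi : i + 1 < m) (hN : j + m + 1 ≤ N) :
    run N j m * gen N (j + i + 1) = gen N (j + i) * run N j m := by
  induction m with
  | zero => omega
  | succ m ih =>
    rw [run]
    by_cases h : i + 1 < m
    · rw [mul_assoc, ih h (by omega), ← mul_assoc, ← mul_assoc,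
        gen_comm N (i := j + i) (j := j + m) (by omega)]
    · obtain rfl : m = i + 1 := by omega
      rw [run, mul_assoc, mul_assoc,
        ← (commute_run N j i (j + i + 1) (Or.inl (by omega))).eq]
      have := gen_braid N (i := j + i) (by omega)
      rw [← add_assoc, ← mul_assoc, ← mul_assoc, ← this]
      simp only [mul_assoc]

theorem crossing_mul_gen (N m n i : ℕ) (hi : i + 1 < m) (hN : n + m ≤ N) :
    crossing N 0 m n * gen N (n + i) = gen N i * crossing N 0 m n := by
  induction n with
  | zero => simp [crossing]
  | succ n ih =>
    rw [crossing, zero_add, mul_assoc, show n + 1 + i = n + i + 1 by omega,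
      run_mul_gen N n m i hi (by omega), ← mul_assoc, ih (by omega), mul_assoc]

/-- Naturality of the braiding in its second variable: `b_{n,m} ∘ (id_n ♮ f) = (f ♮ id_n) ∘ b_{n,m}`
(with further strands on the right). -/
theorem crossing_mul_shift {N m n : ℕ} (hN : n + m ≤ N) (f : Braid m) :
    crossing N 0 m n * shift n hN f = shift 0 (by omega) f * crossing N 0 m n := by
  have : (MulAut.conj (crossing N 0 m n)).toMonoidHom.comp (shift n hN) =
      shift 0 (by omega) := by
    apply PresentedGroup.ext
    intro i
    have hi := i.2
    rw [MonoidHom.comp_apply, of_eq_gen, shift_gen _ _ hi, shift_gen _ _ hi, zero_add]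
    change crossing N 0 m n * gen N (n + i) * (crossing N 0 m n)⁻¹ = _
    rw [crossing_mul_gen N m n i (by omega) hN, mul_inv_cancel_right]
  rw [← this]
  simp

theorem run_add (N j l k : ℕ) : run N j (l + k) = run N (j + l) k * run N j l := by
  induction k with
  | zero => simp [run]
  | succ k ih => rw [← add_assoc, run, run, ih, mul_assoc, add_assoc]

/-- The hexagon identity `b_{n,l+k} = (id_l ♮ b_{n,k}) ∘ (b_{n,l} ♮ id_k)`. -/
theorem crossing_add (N n l k : ℕ) :
    crossing N 0 (l + k) n = crossing N l k n * crossing N 0 l n := by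
  induction n with
  | zero => simp [crossing]
  | succ n ih =>
    rw [crossing, crossing, crossing, ih, zero_add, run_add, mul_assoc, mul_assoc,
      ← mul_assoc (crossing N 0 l n),
      ← (crossing_commute_run N 0 l n (n + l) k (by omega)).eq, mul_assoc, add_comm n l]

end Braid

/-! ### Quillen's bracket construction on the braid groupoid -/

/-- The category `𝔘β`: its objects are the natural numbers. -/
@[ext]
structure UBeta : Type where
  /-- the number of strands -/
  strands : ℕ

namespace UBeta

/-- The image of `g ↦ g ♮ id_{n - k}` from the braid group on `k` strands to the braid group on `n`
strands. -/
def front (k n : ℕ) (h : k ≤ n) : Subgroup (Braid n) :=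
  (Braid.shift (n := k) (N := n) 0 (by omega)).range

/-- A morphism `n → n'` of `𝔘β` exists only if `n ≤ n'`, and is then a class `[n' - n, f]` of
braids `f` on `n'` strands, where `f ∼ f'` if `f = f' ∘ (g ♮ id_n)` for some braid `g` on `n' - n`
strands. -/
@[ext]
structure Hom (X Y : UBeta) : Type where
  le : X.strands ≤ Y.strands
  cls : Braid Y.strands ⧸ front (Y.strands - X.strands) Y.strands (Nat.sub_le _ _)

/-- The morphism `[n' - n, f] : n → n'`. -/
def homMk {X Y : UBeta} (h : X.strands ≤ Y.strands) (f : Braid Y.strands) : Hom X Y :=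
  ⟨h, QuotientGroup.mk f⟩

theorem homMk_eq_iff {X Y : UBeta} {h h' : X.strands ≤ Y.strands} {f f' : Braid Y.strands} :
    homMk h f = homMk h' f' ↔ ∃ g : Braid (Y.strands - X.strands),
      f = f' * Braid.shift 0 (by omega) g := by
  rw [homMk, homMk, Hom.mk.injEq]
  rw [eq_comm, QuotientGroup.eq, front, MonoidHom.mem_range]
  constructor
  · rintro ⟨g, hg⟩
    exact ⟨g, by rw [hg, mul_inv_cancel_left]⟩
  · rintro ⟨g, rfl⟩
    exact ⟨g, by rw [inv_mul_cancel_left]⟩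

theorem exists_homMk {X Y : UBeta} (φ : Hom X Y) : ∃ f, φ = homMk φ.le f := by
  obtain ⟨h, c⟩ := φ
  obtain ⟨f, rfl⟩ := QuotientGroup.mk_surjective c
  exact ⟨f, rfl⟩

/-- Definition of a function on morphisms `X → Y` of `𝔘β` by representatives. -/
def homLift {X Y : UBeta} {S : Sort*} (t : X.strands ≤ Y.strands → Braid Y.strands → S)
    (ht : ∀ h f (g : Braid (Y.strands - X.strands)),
      t h (f * Braid.shift 0 (by omega) g) = t h f) (φ : Hom X Y) : S :=
  Quotient.liftOn' φ.cls (t φ.le) (by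
    intro f f' hff'
    rw [QuotientGroup.leftRel_apply] at hff'
    obtain ⟨g, hg⟩ := hff'
    rw [← ht φ.le f g, hg, mul_inv_cancel_left])

@[simp]
theorem homLift_homMk {X Y : UBeta} {S : Sort*}
    (t : X.strands ≤ Y.strands → Braid Y.strands → S)
    (ht : ∀ h f (g : Braid (Y.strands - X.strands)),
      t h (f * Braid.shift 0 (by omega) g) = t h f)
    (h : X.strands ≤ Y.strands) (f : Braid Y.strands) : homLift t ht (homMk h f) = t h f := rfl

/-- The composition `[n'' - n', g] ∘ [n' - n, f] = [n'' - n, g ∘ (id_{n'' - n'} ♮ f)]`. -/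
def comp {X Y Z : UBeta} (φ : Hom X Y) (ψ : Hom Y Z) : Hom X Z :=
  homLift (fun (hf : X.strands ≤ Y.strands) f =>
    homLift (fun (hg : Y.strands ≤ Z.strands) g =>
      (homMk (hf.trans hg)
        (g * Braid.shift (Z.strands - Y.strands) (by omega) f) : Hom X Z))
      (by
        intro hg g w
        refine homMk_eq_iff.mpr ⟨Braid.shift 0 (by omega) w, ?_⟩
        rw [Braid.shift_shift, mul_assoc, mul_assoc]
        congr 1
        exact (Braid.shift_commute _ _ (by omega) _ _).eq) ψ)
    (by
      intro hf f w
      obtain ⟨g, hg⟩ := exists_homMk ψ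
      rw [hg, homLift_homMk, homLift_homMk]
      refine homMk_eq_iff.mpr
        ⟨Braid.shift (Z.strands - Y.strands) (by have := ψ.le; omega) w, ?_⟩
      rw [map_mul, Braid.shift_shift, Braid.shift_shift, mul_assoc]
      congr 2
      exact Braid.shift_congr (by have := ψ.le; omega) _ _ _) φ

theorem comp_homMk {X Y Z : UBeta} (hf : X.strands ≤ Y.strands) (hg : Y.strands ≤ Z.strands)
    (f : Braid Y.strands) (g : Braid Z.strands) :
    comp (homMk hf f : Hom X Y) (homMk hg g) =
      homMk (hf.trans hg) (g * Braid.shift (Z.strands - Y.strands) (by omega) f) := rfl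

instance : Category UBeta where
  Hom := Hom
  id X := homMk le_rfl 1
  comp := comp
  id_comp := by
    intro X Y φ
    obtain ⟨f, hf⟩ := exists_homMk φ
    rw [hf, comp_homMk, map_one, mul_one]
  comp_id := by
    intro X Y φ
    obtain ⟨f, hf⟩ := exists_homMk φ
    rw [hf, comp_homMk, one_mul]
    refine homMk_eq_iff.mpr ⟨1, ?_⟩
    rw [map_one, mul_one]
    exact (Braid.shift_eq_self (Nat.sub_self _) _ f)
  assoc := by
    intro W X Y Z φ ψ χ
    obtain ⟨f, hf⟩ := exists_homMk φ
    obtain ⟨g, hg⟩ := exists_homMk ψ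
    obtain ⟨k, hk⟩ := exists_homMk χ
    have h2 := ψ.le
    have h3 := χ.le
    rw [hf, hg, hk]
    simp only [comp_homMk, map_mul, mul_assoc, Braid.shift_shift]
    congr 3
    exact Braid.shift_congr (by omega) _ _ _

/-- The morphism `[n' - n, f] : n → n'` of the category `𝔘β`. -/
def bracket {X Y : UBeta} (h : X.strands ≤ Y.strands) (f : Braid Y.strands) : X ⟶ Y := homMk h f

theorem bracket_eq_iff {X Y : UBeta} {h h' : X.strands ≤ Y.strands} {f f' : Braid Y.strands} :
    bracket h f = bracket h' f' ↔ ∃ g : Braid (Y.strands - X.strands),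
      f = f' * Braid.shift 0 (by omega) g := homMk_eq_iff

theorem exists_bracket {X Y : UBeta} (φ : X ⟶ Y) : ∃ h f, φ = bracket h f :=
  ⟨Hom.le (X := X) (Y := Y) φ, exists_homMk φ⟩

theorem bracket_comp_bracket {X Y Z : UBeta} (hf : X.strands ≤ Y.strands) (hg : Y.strands ≤ Z.strands)
    (f : Braid Y.strands) (g : Braid Z.strands) :
    bracket hf f ≫ bracket hg g =
      bracket (hf.trans hg) (g * Braid.shift (Z.strands - Y.strands) (by omega) f) := rfl

theorem id_eq_bracket (X : UBeta) : 𝟙 X = bracket le_rfl 1 := rfl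

/-- A braid `f` on `n` strands as the endomorphism `[0, f]` of `n` in `𝔘β`. -/
def ofBraid (n : ℕ) (f : Braid n) : (⟨n⟩ : UBeta) ⟶ ⟨n⟩ := bracket le_rfl f

theorem ofBraid_mul (n : ℕ) (f g : Braid n) :
    ofBraid n (f * g) = ofBraid n g ≫ ofBraid n f := by
  rw [ofBraid, ofBraid, ofBraid, bracket_comp_bracket]
  congr 2
  exact (Braid.shift_eq_self (Nat.sub_self _) _ g).symm

theorem bracket_comp_ofBraid {X : UBeta} {n : ℕ} (h : X.strands ≤ n) (f g : Braid n) :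
    bracket (Y := ⟨n⟩) h f ≫ ofBraid n g = bracket h (g * f) := by
  rw [ofBraid, bracket_comp_bracket]
  congr 2
  exact Braid.shift_eq_self (Nat.sub_self _) _ f

/-- The product `id_x ♮ [n' - n, f] = [n' - n, (id_x ♮ f) ∘ ((b_{x, n' - n})⁻¹ ♮ id_n)]`. -/
def whiskerHom (x : ℕ) {X Y : UBeta} (φ : X ⟶ Y) :
    (⟨x + X.strands⟩ : UBeta) ⟶ ⟨x + Y.strands⟩ :=
  homLift (fun (h : X.strands ≤ Y.strands) f =>
    bracket (X := ⟨x + X.strands⟩) (Y := ⟨x + Y.strands⟩) (Nat.add_le_add_left h x)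
      (Braid.shift x le_rfl f *
        Braid.shift 0 (by have := h; omega)
          (Braid.braiding x (Y.strands - X.strands))⁻¹))
    (by
      intro h f w
      have hs : x + Y.strands - (x + X.strands) = Y.strands - X.strands := by omega
      refine bracket_eq_iff.mpr ⟨Braid.shift 0 (by simp only; omega) w, ?_⟩
      rw [map_mul, Braid.shift_shift, Braid.shift_shift, map_inv, Braid.braiding,
        Braid.shift_crossing _ _ _ _ (by omega), mul_assoc, mul_assoc]
      congr 1
      rw [eq_inv_mul_iff_mul_eq, ← mul_assoc, mul_inv_eq_iff_eq_mul]
      exact Braid.crossing_mul_shift (N := x + Y.strands) (by omega) w) φ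

theorem whiskerHom_bracket (x : ℕ) {X Y : UBeta} (h : X.strands ≤ Y.strands) (f : Braid Y.strands) :
    whiskerHom x (bracket h f) = bracket (X := ⟨x + X.strands⟩) (Y := ⟨x + Y.strands⟩)
      (Nat.add_le_add_left h x)
      (Braid.shift x le_rfl f *
        (Braid.crossing (x + Y.strands) 0 (Y.strands - X.strands) x)⁻¹) := by
  change bracket _ _ = _
  rw [map_inv, Braid.braiding, Braid.shift_crossing _ _ _ _ (by omega)]

/-- The endofunctor `x ♮ -` of `𝔘β`. -/
abbrev addLeft (x : ℕ) : UBeta ⥤ UBeta where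
  obj X := ⟨x + X.strands⟩
  map φ := whiskerHom x φ
  map_id := by
    intro X
    rw [id_eq_bracket, whiskerHom_bracket, id_eq_bracket]
    congr 1
    rw [map_one, one_mul, inv_eq_one, Nat.sub_self, Braid.crossing_zero]
  map_comp := by
    intro X Y Z φ ψ
    obtain ⟨h, f, rfl⟩ := exists_bracket φ
    obtain ⟨h', g, rfl⟩ := exists_bracket ψ
    rw [bracket_comp_bracket, whiskerHom_bracket, whiskerHom_bracket, whiskerHom_bracket, bracket_comp_bracket]
    congr 1
    have hc : Commute (Braid.crossing (x + Z.strands) 0 (Z.strands - Y.strands) x)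
        (Braid.shift (Z.strands - Y.strands + x) (by omega) f) := by
      have := Braid.shift_commute (m := x + (Z.strands - Y.strands)) (N := x + Z.strands)
        (k := 0) (l := Z.strands - Y.strands + x) (by omega) (by omega) (by omega)
        (Braid.crossing _ 0 (Z.strands - Y.strands) x) f
      rwa [Braid.shift_crossing _ _ _ _ (by omega)] at this
    rw [show Z.strands - X.strands = (Z.strands - Y.strands) + (Y.strands - X.strands) by omega,
      Braid.crossing_add, mul_inv_rev, map_mul, map_mul, map_inv, Braid.shift_shift,
      Braid.shift_shift, Braid.shift_crossing _ _ _ _ (by simp only; omega),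
      Braid.shift_congr (k := x + Z.strands - (x + Y.strands) + x)
        (l := Z.strands - Y.strands + x) (by omega) _ (by simp only; omega),
      Braid.shift_congr (k := x + (Z.strands - Y.strands))
        (l := Z.strands - Y.strands + x) (by omega) _ (by omega),
      show x + Z.strands - (x + Y.strands) + 0 = Z.strands - Y.strands by omega]
    simp only [mul_assoc]
    congr 1
    rw [← mul_assoc, ← mul_assoc, hc.inv_left.eq]

/-- The morphism `ι_x ♮ id_n = [x, id_{x + n}] : n → x ♮ n`. -/
def unitHom (x : ℕ) (X : UBeta) : X ⟶ (addLeft x).obj X :=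
  bracket (Y := (addLeft x).obj X) (Nat.le_add_left _ _) 1

theorem unitHom_naturality (x : ℕ) {X Y : UBeta} (φ : X ⟶ Y) :
    φ ≫ unitHom x Y = unitHom x X ≫ (addLeft x).map φ := by
  obtain ⟨h, f, rfl⟩ := exists_bracket φ
  change bracket h f ≫ bracket _ 1 = bracket _ 1 ≫ whiskerHom x (bracket h f)
  rw [whiskerHom_bracket, bracket_comp_bracket, bracket_comp_bracket, map_one, one_mul, mul_one]
  refine bracket_eq_iff.mpr
    ⟨Braid.crossing (x + Y.strands - X.strands) 0 (Y.strands - X.strands) x, ?_⟩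
  rw [Braid.shift_crossing _ _ _ _ (by simp only; omega)]
  refine (Braid.shift_congr ?_ _ _ f).trans (inv_mul_cancel_right _ _).symm
  exact Nat.add_sub_cancel _ _

end UBeta

/-! ### Strong polynomial functors on `𝔘β` -/

section StrongPolynomial

universe v w

variable {A : Type w} [Category.{v} A]

/-- The translation functor `τ_x`: precomposition with `x ♮ -`. -/
def translation (x : ℕ) : (UBeta ⥤ A) ⥤ (UBeta ⥤ A) :=
  (Functor.whiskeringLeft UBeta UBeta A).obj (UBeta.addLeft x)

/-- The natural transformation `i_x : Id → τ_x` induced by `ι_x : 0 → x`. -/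
def translationUnit (x : ℕ) : 𝟭 (UBeta ⥤ A) ⟶ translation x where
  app F :=
    { app := fun X => F.map (UBeta.unitHom x X)
      naturality := fun X Y φ => by
        change F.map φ ≫ F.map _ = F.map _ ≫ F.map ((UBeta.addLeft x).map φ)
        rw [← F.map_comp, ← F.map_comp, UBeta.unitHom_naturality] }
  naturality F G η := by
    ext X
    exact (η.naturality (UBeta.unitHom x X)).symm

variable [Abelian A]

/-- The difference functor `δ_x`, the cokernel of `i_x`, on objects. -/
noncomputable def difference (x : ℕ) (F : UBeta ⥤ A) : UBeta ⥤ A :=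
  cokernel ((translationUnit x).app F)

/-- `IsStrongPolynomial d F`: the functor `F` is strong polynomial of degree at most `d`.
In degree at most `-1` this means that `F` is null, so that in degree at most `0` it means that all
`δ_x F` are null. -/
def IsStrongPolynomial : ℕ → (UBeta ⥤ A) → Prop
  | 0, F => ∀ x : ℕ, IsZero (difference x F)
  | d + 1, F => ∀ x : ℕ, IsStrongPolynomial d (difference x F)

/-- The strong degree of `F` is `d`: this is the smallest natural number such that `F` is strong
polynomial of degree at most `d`. -/
def HasStrongDegree (d : ℕ) (F : UBeta ⥤ A) : Prop :=
  IsLeast {m : ℕ | IsStrongPolynomial m F} d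

end StrongPolynomial

/-! ### Coherent and reliable families of morphisms -/

/-- `ι * id : F_n → F_{n'}`, the inclusion of `F_n` on the last `n` generators. -/
def freeLast {n n' : ℕ} (h : n ≤ n') : FreeGroup (Fin n) →* FreeGroup (Fin n') :=
  FreeGroup.map fun i => ⟨n' - n + i, by omega⟩

/-- `id * ι : F_n → F_{n'}`, the inclusion of `F_n` on the first `n` generators. -/
def freeFirst {n n' : ℕ} (h : n ≤ n') : FreeGroup (Fin n) →* FreeGroup (Fin n') :=
  FreeGroup.map (Fin.castLE h)

theorem freeLast_freeLast {n n' n'' : ℕ} (h : n ≤ n') (h' : n' ≤ n'') (g : FreeGroup (Fin n)) :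
    freeLast h' (freeLast h g) = freeLast (h.trans h') g := by
  have : (freeLast h').comp (freeLast h) = freeLast (h.trans h') := by
    ext i
    simp only [MonoidHom.comp_apply, freeLast, FreeGroup.map.of]
    congr 2
    omega
  exact DFunLike.congr_fun this g

theorem freeLast_self {n : ℕ} (h : n ≤ n) (g : FreeGroup (Fin n)) : freeLast h g = g := by
  have : freeLast h = MonoidHom.id (FreeGroup (Fin n)) := by
    ext i
    simp only [freeLast, FreeGroup.map.of, MonoidHom.id_apply]
    congr 1
    ext
    simp
  exact DFunLike.congr_fun this g

/-- Coherence of a family of group morphisms `ς_n : F_n → B_{1+n}` and a family of actions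
`a_n : B_n → Aut(F_n)`. -/
structure IsCoherent (a : ∀ n : ℕ, Braid n →* MulAut (FreeGroup (Fin n)))
    (ς : ∀ n : ℕ, FreeGroup (Fin n) →* Braid (1 + n)) : Prop where
  /-- `(id_1 ♮ [n' - n, id]) ∘ ς_n(g) = ς_{n'}(e * g) ∘ (id_1 ♮ [n' - n, id])` in `𝔘β` -/
  stability : ∀ (n n' : ℕ) (h : n ≤ n') (g : FreeGroup (Fin n)),
    UBeta.ofBraid (1 + n) (ς n g) ≫
        (UBeta.addLeft 1).map (UBeta.bracket (X := ⟨n⟩) (Y := ⟨n'⟩) h 1) =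
      (UBeta.addLeft 1).map (UBeta.bracket (X := ⟨n⟩) (Y := ⟨n'⟩) h 1) ≫
        UBeta.ofBraid (1 + n') (ς n' (freeLast h g))
  /-- `(ι * id) ∘ a_n(σ) = a_{n'}(σ' ♮ σ) ∘ (ι * id)` -/
  action : ∀ (n n' : ℕ) (h : n ≤ n') (σ : Braid n) (σ' : Braid (n' - n)) (g : FreeGroup (Fin n)),
    freeLast h (a n σ g) =
      a n' (Braid.shift 0 (by omega) σ' * Braid.shift (n' - n) (by omega) σ) (freeLast h g)
  /-- `(id_1 ♮ σ) ∘ ς_n(g) = ς_n(a_n(σ)(g)) ∘ (id_1 ♮ σ)` -/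
  compatibility : ∀ (n : ℕ) (σ : Braid n) (g : FreeGroup (Fin n)),
    Braid.shift 1 le_rfl σ * ς n g = ς n (a n σ g) * Braid.shift 1 le_rfl σ

/-- The conditions on the actions `a_n : B_n → Aut(F_n)` under which coherent families are
reliable. -/
structure IsReliable (a : ∀ n : ℕ, Braid n →* MulAut (FreeGroup (Fin n))) : Prop where
  /-- `a_{1+n'}((b_{1,n'-n})⁻¹ ♮ id_n) ∘ (ι_{F_{n'-n}} * id_{F_{1+n}}) ∘ (id_{F_1} * ι_{F_n})` is
  equal to `id_{F_1} * ι_{F_{n'}}` -/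
  braiding : ∀ (n n' : ℕ) (h : n ≤ n') (g : FreeGroup (Fin 1)),
    a (1 + n') (Braid.shift 0 (by omega) (Braid.braiding 1 (n' - n))⁻¹)
        (freeLast (Nat.add_le_add_left h 1) (freeFirst (Nat.le_add_right 1 n) g)) =
      freeFirst (Nat.le_add_right 1 n') g
  /-- `a_{n'}(id_{n'-n} ♮ σ)` fixes the first `n' - n` generators -/
  stabilizer : ∀ (n n' : ℕ) (h : n ≤ n') (σ : Braid n) (g : FreeGroup (Fin (n' - n))),
    a n' (Braid.shift (n' - n) (by omega) σ) (freeFirst (Nat.sub_le n' n) g) =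
      freeFirst (Nat.sub_le n' n) g

/-! ### The augmentation ideal and tensor products with it -/

section Augmentation

variable (K : Type u) [CommRing K]

/-- The augmentation ideal of the group ring `K[G]`, the kernel of the augmentation. -/
noncomputable def augIdeal (G : Type*) [Group G] : Submodule K (MonoidAlgebra K G) :=
  LinearMap.ker (MonoidAlgebra.lift K K G (1 : G →* K)).toLinearMap

variable {K}

theorem mem_augIdeal {G : Type*} [Group G] {x : MonoidAlgebra K G} :
    x ∈ augIdeal K G ↔ MonoidAlgebra.lift K K G (1 : G →* K) x = 0 := Iff.rfl

/-- The right action of `K[G]` on the augmentation ideal. -/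
noncomputable def augIdealMul {G : Type*} [Group G] (i : augIdeal K G) (r : MonoidAlgebra K G) :
    augIdeal K G :=
  ⟨i * r, by rw [mem_augIdeal, map_mul, mem_augIdeal.mp i.2, zero_mul]⟩

/-- The map of augmentation ideals induced by a group morphism. -/
noncomputable def augIdealMap {G H : Type*} [Group G] [Group H] (f : G →* H) :
    augIdeal K G →ₗ[K] augIdeal K H :=
  (MonoidAlgebra.mapDomainAlgHom K K f).toLinearMap.restrict (by
    intro x hx
    rw [mem_augIdeal] at hx ⊢
    have : (MonoidAlgebra.lift K K H (1 : H →* K)).comp (MonoidAlgebra.mapDomainAlgHom K K f) =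
        MonoidAlgebra.lift K K G (1 : G →* K) := by
      ext g
      simp
    rw [← hx, ← this]
    rfl)

theorem augIdealMap_id {G : Type*} [Group G] (i : augIdeal K G) :
    augIdealMap (MonoidHom.id G) i = i := by
  ext1
  exact DFunLike.congr_fun (MonoidAlgebra.mapDomainAlgHom_id (R := K) (A := K) (M := G)) i.1

theorem augIdealMap_comp {G H L : Type*} [Group G] [Group H] [Group L] (f : G →* H) (f' : H →* L)
    (i : augIdeal K G) : augIdealMap (f'.comp f) i = augIdealMap f' (augIdealMap f i) := by
  ext1
  exact DFunLike.congr_fun (MonoidAlgebra.mapDomainAlgHom_comp (R := K) (A := K) f f') i.1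

theorem coe_augIdealMap {G H : Type*} [Group G] [Group H] (f : G →* H) (i : augIdeal K G) :
    (augIdealMap f i : MonoidAlgebra K H) = MonoidAlgebra.mapDomainAlgHom K K f i := rfl

variable {G : Type} [Group G] {M : Type u} [AddCommGroup M] [Module K M]

noncomputable instance : AddCommGroup (augIdeal K G) :=
  { (inferInstance : AddCommMonoid (augIdeal K G)) with
    neg := fun x => ⟨-x.1, by rw [mem_augIdeal, map_neg, mem_augIdeal.mp x.2, neg_zero]⟩
    sub := fun x y => ⟨x.1 - y.1, by
      rw [mem_augIdeal, map_sub, mem_augIdeal.mp x.2, mem_augIdeal.mp y.2, sub_zero]⟩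
    sub_eq_add_neg := fun x y => Subtype.ext (sub_eq_add_neg x.1 y.1)
    zsmul := zsmulRec
    neg_add_cancel := fun x => Subtype.ext (neg_add_cancel x.1) }

/-- The submodule of `I ⊗_K M`, for `I` the augmentation ideal of `K[G]`, which is generated by the
elements `i r ⊗ v - i ⊗ r v` with `r` in `K[G]`. -/
noncomputable def augTensorRel (ρ : Representation K G M) : Submodule K (augIdeal K G ⊗[K] M) :=
  Submodule.span K {z | ∃ (i : augIdeal K G) (r : MonoidAlgebra K G) (v : M),
    z = augIdealMul i r ⊗ₜ[K] v - i ⊗ₜ[K] ρ.asAlgebraHom r v}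

/-- The tensor product `I ⊗_{K[G]} M` of the augmentation ideal `I` of `K[G]` with the left
`K[G]`-module given by a representation of `G` on `M`. -/
abbrev AugTensor (ρ : Representation K G M) : Type u :=
  (augIdeal K G ⊗[K] M) ⧸ augTensorRel ρ

namespace AugTensor

/-- The element `i ⊗ v`. -/
noncomputable def tmul (ρ : Representation K G M) (i : augIdeal K G) (v : M) : AugTensor ρ :=
  Submodule.Quotient.mk (i ⊗ₜ[K] v)

variable {H : Type} [Group H] {N : Type u} [AddCommGroup N] [Module K N]

theorem intertwine (ρ : Representation K G M) (ρ' : Representation K H N) (f : G →* H)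
    (φ : M →ₗ[K] N) (hφ : ∀ g v, φ (ρ g v) = ρ' (f g) (φ v)) (r : MonoidAlgebra K G) (v : M) :
    φ (ρ.asAlgebraHom r v) =
      ρ'.asAlgebraHom (MonoidAlgebra.mapDomainAlgHom K K f r) (φ v) := by
  induction r using MonoidAlgebra.induction_linear with
  | zero => simp
  | add x y hx hy => simp only [map_add, LinearMap.add_apply, hx, hy]
  | single g c => simp [hφ]

/-- The map `i ⊗ v ↦ f(i) ⊗ φ(v)` induced by a group morphism `f` and an `f`-equivariant map `φ`. -/
noncomputable def map (ρ : Representation K G M) (ρ' : Representation K H N) (f : G →* H) (φ : M →ₗ[K] N)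
    (hφ : ∀ g v, φ (ρ g v) = ρ' (f g) (φ v)) : AugTensor ρ →ₗ[K] AugTensor ρ' :=
  Submodule.mapQ _ _ (TensorProduct.map (augIdealMap f) φ) (by
    refine Submodule.span_le.mpr ?_
    rintro _ ⟨i, r, v, rfl⟩
    refine Submodule.subset_span
      ⟨augIdealMap f i, MonoidAlgebra.mapDomainAlgHom K K f r, φ v, ?_⟩
    rw [map_sub, TensorProduct.map_tmul, TensorProduct.map_tmul, intertwine ρ ρ' f φ hφ]
    congr 2
    ext1
    simp only [coe_augIdealMap, augIdealMul, map_mul])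

@[simp]
theorem map_tmul (ρ : Representation K G M) (ρ' : Representation K H N) (f : G →* H)
    (φ : M →ₗ[K] N) (hφ : ∀ g v, φ (ρ g v) = ρ' (f g) (φ v)) (i : augIdeal K G) (v : M) :
    map ρ ρ' f φ hφ (tmul ρ i v) = tmul ρ' (augIdealMap f i) (φ v) := rfl

theorem hom_ext {ρ : Representation K G M} {P : Type*} [AddCommGroup P] [Module K P]
    {s t : AugTensor ρ →ₗ[K] P} (h : ∀ i v, s (tmul ρ i v) = t (tmul ρ i v)) : s = t :=
  Submodule.linearMap_qext _ (TensorProduct.ext' h)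

end AugTensor

end Augmentation

/-! ### The Long-Moody functor -/

section LongMoody

/-- For `[n' - n, σ] : n → n'` in `𝔘β`, the morphism `a_{n'}(σ) ∘ (ι * id) : F_n → F_{n'}`. -/
def freeAction {a : ∀ n : ℕ, Braid n →* MulAut (FreeGroup (Fin n))}
    {ς : ∀ n : ℕ, FreeGroup (Fin n) →* Braid (1 + n)} (hc : IsCoherent a ς)
    {X Y : UBeta} (φ : X ⟶ Y) : FreeGroup (Fin X.strands) →* FreeGroup (Fin Y.strands) :=
  UBeta.homLift (fun (h : X.strands ≤ Y.strands) σ => (a Y.strands σ).toMonoidHom.comp (freeLast h))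
    (by
      intro h σ w
      ext1 i
      have := hc.action X.strands Y.strands h 1 w (.of i)
      simp only [map_one, mul_one, MulAut.one_apply] at this
      simp only [map_mul, MonoidHom.comp_apply, MulEquiv.coe_toMonoidHom, MulAut.mul_apply, ← this])
    φ

variable {a : ∀ n : ℕ, Braid n →* MulAut (FreeGroup (Fin n))}
  {ς : ∀ n : ℕ, FreeGroup (Fin n) →* Braid (1 + n)}

theorem freeAction_bracket (hc : IsCoherent a ς) {X Y : UBeta} (h : X.strands ≤ Y.strands)
    (σ : Braid Y.strands) (g : FreeGroup (Fin X.strands)) :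
    freeAction hc (UBeta.bracket h σ) g = a Y.strands σ (freeLast h g) := rfl

theorem freeAction_id (hc : IsCoherent a ς) (X : UBeta) :
    freeAction hc (𝟙 X) = MonoidHom.id _ := by
  ext1 i
  rw [UBeta.id_eq_bracket, freeAction_bracket, map_one, freeLast_self]
  rfl

theorem freeAction_comp (hc : IsCoherent a ς) {X Y Z : UBeta} (φ : X ⟶ Y) (ψ : Y ⟶ Z) :
    freeAction hc (φ ≫ ψ) = (freeAction hc ψ).comp (freeAction hc φ) := by
  obtain ⟨h, f, rfl⟩ := UBeta.exists_bracket φ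
  obtain ⟨h', g, rfl⟩ := UBeta.exists_bracket ψ
  ext1 i
  have := hc.action _ _ h' f 1 (freeLast h (.of i))
  rw [map_one, one_mul] at this
  rw [UBeta.bracket_comp_bracket, MonoidHom.comp_apply, freeAction_bracket, freeAction_bracket,
    freeAction_bracket, map_mul, MulAut.mul_apply, this, freeLast_freeLast]

theorem freeAction_equivariant (hc : IsCoherent a ς) {X Y : UBeta} (φ : X ⟶ Y)
    (g : FreeGroup (Fin X.strands)) :
    UBeta.ofBraid (1 + X.strands) (ς X.strands g) ≫ (UBeta.addLeft 1).map φ =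
      (UBeta.addLeft 1).map φ ≫ UBeta.ofBraid (1 + Y.strands) (ς Y.strands (freeAction hc φ g)) := by
  obtain ⟨h, σ, rfl⟩ := UBeta.exists_bracket φ
  have h1 : (UBeta.bracket h σ : X ⟶ Y) = UBeta.bracket h 1 ≫ UBeta.ofBraid Y.strands σ := by
    rw [UBeta.bracket_comp_ofBraid, mul_one]
  have h2 : (UBeta.addLeft 1).map (UBeta.ofBraid Y.strands σ) =
      UBeta.ofBraid (1 + Y.strands) (Braid.shift 1 le_rfl σ) := by
    change UBeta.whiskerHom 1 (UBeta.bracket le_rfl σ) = _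
    rw [UBeta.whiskerHom_bracket, Nat.sub_self, Braid.crossing_zero, inv_one, mul_one]
    rfl
  rw [freeAction_bracket, h1, Functor.map_comp, h2, ← Category.assoc,
    hc.stability X.strands Y.strands h g, Category.assoc, Category.assoc, ← UBeta.ofBraid_mul,
    ← UBeta.ofBraid_mul, hc.compatibility]

variable {K : Type u} [CommRing K]

/-- The representation of the braid group on `n` strands on `F(n)`. -/
noncomputable def braidRep (F : UBeta ⥤ ModuleCat.{u} K) (n : ℕ) : Representation K (Braid n) (F.obj ⟨n⟩) where
  toFun σ := (F.map (UBeta.ofBraid n σ)).hom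
  map_one' := by
    change (F.map (𝟙 _)).hom = _
    rw [F.map_id]
    rfl
  map_mul' σ σ' := by
    rw [UBeta.ofBraid_mul, F.map_comp]
    rfl

/-- The representation of the free group `F_n` on `F(1 + n)` obtained by restriction along
`ς_n`. -/
noncomputable def freeRep (ς : ∀ n : ℕ, FreeGroup (Fin n) →* Braid (1 + n)) (F : UBeta ⥤ ModuleCat.{u} K)
    (n : ℕ) : Representation K (FreeGroup (Fin n)) (F.obj ⟨1 + n⟩) :=
  (braidRep F (1 + n)).comp (ς n)

/-- The functor `LM(F)`, with `LM(F)(n) = I ⊗_{K[F_n]} F(1 + n)`, where `I` is the augmentation ideal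
of `K[F_n]`, and with
`LM(F)([n' - n, σ]) (i ⊗ v) = a_{n'}(σ)((ι * id)(i)) ⊗ F(id_1 ♮ [n' - n, σ])(v)`. -/
noncomputable def longMoodyObj (hc : IsCoherent a ς) (F : UBeta ⥤ ModuleCat.{u} K) :
    UBeta ⥤ ModuleCat.{u} K where
  obj X := ModuleCat.of K (AugTensor (freeRep ς F X.strands))
  map {X Y} φ := ModuleCat.ofHom (AugTensor.map (freeRep ς F X.strands) (freeRep ς F Y.strands)
    (freeAction hc φ) (F.map ((UBeta.addLeft 1).map φ)).hom (fun g v => by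
      have := congrArg F.map (freeAction_equivariant hc φ g)
      rw [F.map_comp, F.map_comp] at this
      exact LinearMap.congr_fun (congrArg ModuleCat.Hom.hom this) v))
  map_id := by
    intro X
    ext1
    refine AugTensor.hom_ext fun i v => ?_
    change AugTensor.tmul (freeRep ς F X.strands) (augIdealMap (freeAction hc (𝟙 X)) i)
      ((F.map ((UBeta.addLeft 1).map (𝟙 X))).hom v) = AugTensor.tmul (freeRep ς F X.strands) i v
    rw [freeAction_id, augIdealMap_id, (UBeta.addLeft 1).map_id, F.map_id]
    rfl
  map_comp := by
    intro X Y Z φ ψ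
    ext1
    refine AugTensor.hom_ext fun i v => ?_
    change AugTensor.tmul (freeRep ς F Z.strands) (augIdealMap (freeAction hc (φ ≫ ψ)) i)
        ((F.map ((UBeta.addLeft 1).map (φ ≫ ψ))).hom v) =
      AugTensor.tmul (freeRep ς F Z.strands)
        (augIdealMap (freeAction hc ψ) (augIdealMap (freeAction hc φ) i))
        ((F.map ((UBeta.addLeft 1).map ψ)).hom ((F.map ((UBeta.addLeft 1).map φ)).hom v))
    rw [freeAction_comp, augIdealMap_comp, (UBeta.addLeft 1).map_comp, F.map_comp]
    rfl

/-- The Long-Moody functor `LM` of coherent families of morphisms. -/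
noncomputable def longMoody (hc : IsCoherent a ς) :
    (UBeta ⥤ ModuleCat.{u} K) ⥤ (UBeta ⥤ ModuleCat.{u} K) where
  obj F := longMoodyObj hc F
  map {F G} η :=
    { app := fun X => ModuleCat.ofHom (AugTensor.map (freeRep ς F X.strands)
        (freeRep ς G X.strands) (MonoidHom.id _) (η.app ⟨1 + X.strands⟩).hom (fun g v =>
          LinearMap.congr_fun (congrArg ModuleCat.Hom.hom (η.naturality _)) v))
      naturality := fun X Y φ => by
        ext1
        refine AugTensor.hom_ext fun i v => ?_
        change AugTensor.tmul (freeRep ς G Y.strands)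
            (augIdealMap (MonoidHom.id _) (augIdealMap (freeAction hc φ) i))
            ((η.app ⟨1 + Y.strands⟩).hom ((F.map ((UBeta.addLeft 1).map φ)).hom v)) =
          AugTensor.tmul (freeRep ς G Y.strands)
            (augIdealMap (freeAction hc φ) (augIdealMap (MonoidHom.id _) i))
            ((G.map ((UBeta.addLeft 1).map φ)).hom ((η.app ⟨1 + X.strands⟩).hom v))
        rw [augIdealMap_id, augIdealMap_id]
        exact congrArg (AugTensor.tmul _ _) (LinearMap.congr_fun
          (congrArg ModuleCat.Hom.hom (η.naturality ((UBeta.addLeft 1).map φ))) v) }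
  map_id F := by
    ext1; ext1 X; ext1
    refine AugTensor.hom_ext fun i v => ?_
    change AugTensor.tmul (freeRep ς F X.strands) (augIdealMap (MonoidHom.id _) i) v =
      AugTensor.tmul (freeRep ς F X.strands) i v
    rw [augIdealMap_id]
  map_comp {F G H} η θ := by
    ext1; ext1 X; ext1
    refine AugTensor.hom_ext fun i v => ?_
    change AugTensor.tmul (freeRep ς H X.strands) (augIdealMap (MonoidHom.id _) i)
        ((θ.app ⟨1 + X.strands⟩).hom ((η.app ⟨1 + X.strands⟩).hom v)) =
      AugTensor.tmul (freeRep ς H X.strands)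
        (augIdealMap (MonoidHom.id _) (augIdealMap (MonoidHom.id _) i))
        ((θ.app ⟨1 + X.strands⟩).hom ((η.app ⟨1 + X.strands⟩).hom v))
    rw [augIdealMap_id, augIdealMap_id]

end LongMoody

/-! The augmentation ideal of `K[F_n]` is a free right module on the elements x - 1, for x a
generator. Hence, as a module, LM(F)(n) is a sum of n copies of F(1 + n). In τ_1(LM F)(n) the new
first generator contributes one copy of F(1 + (1 + n)). The other generators contribute a copy of
LM(τ_1 F)(n), embedded with the help of the braids (b_{1,1})⁻¹ ♮ id_n, which exchange the strand
added by LM and the one added by τ_1. Coherence makes this embedding well defined and natural.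
Reliability says that id_1 ♮ φ fixes the first generator, so the projection to the first copy is
natural too. The map i_1 of LM(F) is LM(i_1) followed by the embedding, so passing to cokernels
gives a sequence LM(δ_1 F) → δ_1(LM F) → τ_1 τ_1 F → 0 (`exists_isRightExact_difference_longMoody`).

Both bounds follow from this sequence once degree is measured by δ_1 alone: F has degree at most d
exactly when the (d + 1)-fold difference δ_1 ⋯ δ_1 F is null
(`isStrongPolynomial_iff_iterDifferenceVanishes`). Indeed i_{x+1} is i_1 followed by τ_1(i_x), which
places δ_{x+1} F between δ_1 F and τ_1 δ_x F; moreover τ_1 does not raise the degree, because τ_1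
δ_1 F surjects onto δ_1 τ_1 F.

Upper bound: in the sequence, LM(δ_1 F) is controlled by induction and τ_1 τ_1 F has degree at most
that of F. Lower bound: δ_1(LM F) surjects onto τ_1 τ_1 F ≅ τ_2 F, so a bound m on the degree of
LM(F) forces the bound m - 1 for τ_2 F.

Since δ_1 is a cokernel, it preserves surjectivity on the right and exactness in the middle, and
nullity of the middle term needs nothing more. No injectivity is used anywhere. -/

open ZeroObject

/-! ### Right exact sequences of functors with values in modules -/

section RightExact

variable {C : Type*} [Category* C] {K : Type u} [CommRing K]

/-- Pointwise, the second map of `P → Q → R` is surjective and its kernel is contained in the image of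
the first one; the composite `P → R` need not vanish. -/
def IsRightExact {P Q R : C ⥤ ModuleCat.{u} K} (f : P ⟶ Q) (g : Q ⟶ R) : Prop :=
  ∀ X, Function.Surjective (g.app X) ∧ ∀ b, g.app X b = 0 → ∃ a, f.app X a = b

theorem subsingleton_obj_of_isZero {F : C ⥤ ModuleCat.{u} K} (hF : IsZero F) (X : C) :
    Subsingleton (F.obj X) :=
  ModuleCat.isZero_iff_subsingleton.mp (hF.obj X)

theorem isZero_of_subsingleton_obj {F : C ⥤ ModuleCat.{u} K} (h : ∀ X, Subsingleton (F.obj X)) :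
    IsZero F :=
  (Functor.isZero_iff F).mpr fun X => ModuleCat.isZero_iff_subsingleton.mpr (h X)

theorem IsRightExact.isZero {P Q R : C ⥤ ModuleCat.{u} K} {f : P ⟶ Q} {g : Q ⟶ R}
    (h : IsRightExact f g) (hP : IsZero P) (hR : IsZero R) : IsZero Q := by
  refine isZero_of_subsingleton_obj fun X => subsingleton_of_forall_eq 0 fun b => ?_
  have := subsingleton_obj_of_isZero hP X
  have := subsingleton_obj_of_isZero hR X
  obtain ⟨a, rfl⟩ := (h X).2 b (Subsingleton.elim _ _)
  rw [Subsingleton.elim a 0, map_zero]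

theorem isRightExact_of_surjective {P Q : C ⥤ ModuleCat.{u} K} (f : P ⟶ Q)
    (hf : ∀ X, Function.Surjective (f.app X)) :
    IsRightExact f (0 : Q ⟶ (0 : C ⥤ ModuleCat.{u} K)) := fun X =>
  ⟨fun _ => ⟨0, (subsingleton_obj_of_isZero (isZero_zero _) X).elim _ _⟩, fun b _ => hf X b⟩

theorem surjective_app_of_epi {P Q : C ⥤ ModuleCat.{u} K} (f : P ⟶ Q) [Epi f] (X : C) :
    Function.Surjective (f.app X) :=
  (ModuleCat.epi_iff_surjective _).mp inferInstance

/-- At each object a surjection is the cokernel of its kernel, which yields the components. They are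
natural because the components of `w` can be cancelled. All the maps between difference functors
below, except `differenceMap`, are obtained this way. -/
theorem exists_desc_of_surjective {P Q T : C ⥤ ModuleCat.{u} K} (w : P ⟶ Q) (t : P ⟶ T)
    (hw : ∀ X, Function.Surjective (w.app X)) (h : ∀ X a, w.app X a = 0 → t.app X a = 0) :
    ∃ v : Q ⟶ T, w ≫ v = t := by
  have hepi : ∀ X, Epi (w.app X) := fun X => (ModuleCat.epi_iff_surjective _).mpr (hw X)
  have hv : ∀ X, ∃ v : Q.obj X ⟶ T.obj X, w.app X ≫ v = t.app X := fun X => by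
    have hex : (ShortComplex.mk (kernel.ι (w.app X)) (w.app X) (kernel.condition _)).Exact :=
      ShortComplex.exact_kernel _
    have := hepi X
    refine ⟨hex.desc (t.app X) ?_, hex.g_desc _ _⟩
    ext a
    exact h X _ (by
      change (kernel.ι (w.app X) ≫ w.app X) a = 0
      rw [kernel.condition]; rfl)
  choose v hv using hv
  refine ⟨{ app := v, naturality := fun X Y φ => ?_ }, by ext1; funext X; exact hv X⟩
  have := hepi X
  rw [← cancel_epi (w.app X), ← Category.assoc, ← w.naturality, Category.assoc, hv, ← Category.assoc,
    hv, t.naturality]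

end RightExact

/-! ### Right exactness of the difference functors -/

section Difference

variable {K : Type u} [CommRing K]

/-- The projection `τ_x F → δ_x F`. -/
noncomputable def differenceProj (x : ℕ) (F : UBeta ⥤ ModuleCat.{u} K) :
    (translation x).obj F ⟶ difference x F :=
  cokernel.π ((translationUnit x).app F)

theorem isRightExact_differenceProj (x : ℕ) (F : UBeta ⥤ ModuleCat.{u} K) :
    IsRightExact ((translationUnit x).app F) (differenceProj x F) := fun X => by
  have : Epi (differenceProj x F) := inferInstanceAs (Epi (cokernel.π _))
  refine ⟨surjective_app_of_epi _ X, fun b hb => ?_⟩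
  -- Evaluation at an object is exact, so the cokernel sequence in the functor category is exact
  -- pointwise.
  have hex := (ShortComplex.exact_cokernel ((translationUnit x).app F)).map
    ((evaluation UBeta (ModuleCat.{u} K)).obj X)
  exact (ShortComplex.moduleCat_exact_iff _).mp hex b hb

theorem differenceProj_surjective (x : ℕ) (F : UBeta ⥤ ModuleCat.{u} K) (X : UBeta) :
    Function.Surjective ((differenceProj x F).app X) := (isRightExact_differenceProj x F X).1

theorem differenceProj_app_translationUnit (x : ℕ) (F : UBeta ⥤ ModuleCat.{u} K) (X : UBeta)
    (v : F.obj X) :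
    (differenceProj x F).app X (((translationUnit x).app F).app X v) = 0 := by
  have := NatTrans.congr_app (cokernel.condition ((translationUnit x).app F)) X
  exact LinearMap.congr_fun (congrArg ModuleCat.Hom.hom this) v

/-- A morphism out of `τ_x F` which vanishes on the image of `i_x` factors through `δ_x F`. -/
theorem exists_desc_difference {x : ℕ} {F T : UBeta ⥤ ModuleCat.{u} K}
    (t : (translation x).obj F ⟶ T)
    (h : ∀ X v, t.app X (((translationUnit x).app F).app X v) = 0) :
    ∃ v : difference x F ⟶ T, differenceProj x F ≫ v = t :=
  exists_desc_of_surjective _ _ (differenceProj_surjective x F) fun X a ha => by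
    obtain ⟨w, rfl⟩ := (isRightExact_differenceProj x F X).2 a ha
    exact h X w

/-- The map `δ_x F → δ_x G` induced by a natural transformation `F → G`. -/
noncomputable def differenceMap (x : ℕ) {F G : UBeta ⥤ ModuleCat.{u} K} (η : F ⟶ G) :
    difference x F ⟶ difference x G :=
  cokernel.map _ _ η ((translation x).map η) ((translationUnit x).naturality η).symm

theorem differenceMap_app_differenceProj (x : ℕ) {F G : UBeta ⥤ ModuleCat.{u} K} (η : F ⟶ G)
    (X : UBeta) (v : ((translation x).obj F).obj X) :
    (differenceMap x η).app X ((differenceProj x F).app X v) =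
      (differenceProj x G).app X (((translation x).map η).app X v) := by
  have : differenceProj x F ≫ differenceMap x η = (translation x).map η ≫ differenceProj x G :=
    cokernel.π_desc _ _ _
  exact LinearMap.congr_fun (congrArg ModuleCat.Hom.hom (NatTrans.congr_app this X)) v

theorem translationUnit_naturality_apply (x : ℕ) {F G : UBeta ⥤ ModuleCat.{u} K} (η : F ⟶ G)
    (X : UBeta) (v : F.obj X) :
    ((translationUnit x).app G).app X (η.app X v) =
      ((translation x).map η).app X (((translationUnit x).app F).app X v) :=
  LinearMap.congr_fun (congrArg ModuleCat.Hom.hom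
    (NatTrans.congr_app ((translationUnit x).naturality η) X)) v

theorem isRightExact_translation {P Q R : UBeta ⥤ ModuleCat.{u} K} {f : P ⟶ Q} {g : Q ⟶ R}
    (h : IsRightExact f g) (x : ℕ) :
    IsRightExact ((translation x).map f) ((translation x).map g) := fun _ => h _

/-- A diagram chase in the two rows F → τ_x F → δ_x F → 0: surjectivity of `g` before translation is
what allows a representative to be corrected. -/
theorem isRightExact_differenceMap {P Q R : UBeta ⥤ ModuleCat.{u} K} {f : P ⟶ Q} {g : Q ⟶ R}
    (h : IsRightExact f g) (x : ℕ) :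
    IsRightExact (differenceMap x f) (differenceMap x g) := fun X => by
  have hX := isRightExact_translation h x X
  refine ⟨fun c => ?_, fun b hb => ?_⟩
  · obtain ⟨c, rfl⟩ := differenceProj_surjective x R X c
    obtain ⟨b, rfl⟩ := hX.1 c
    exact ⟨_, differenceMap_app_differenceProj x g X b⟩
  · obtain ⟨b, rfl⟩ := differenceProj_surjective x Q X b
    rw [differenceMap_app_differenceProj] at hb
    obtain ⟨c, hc⟩ := (isRightExact_differenceProj x R X).2 _ hb
    obtain ⟨b', rfl⟩ := (h X).1 c
    rw [translationUnit_naturality_apply] at hc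
    -- The image of `b` in τ_x R comes from R, hence from some `b'` in Q. Subtracting i_x(b') does
    -- not change the class in δ_x Q and puts the representative in the kernel of τ_x(g).
    obtain ⟨a, ha⟩ := hX.2 (b - ((translationUnit x).app Q).app X b')
      (by rw [map_sub, hc, sub_self])
    refine ⟨(differenceProj x P).app X a, ?_⟩
    rw [differenceMap_app_differenceProj, ha, map_sub]
    exact (congrArg _ (differenceProj_app_translationUnit x Q X b')).trans (sub_zero _)

theorem isZero_difference {F : UBeta ⥤ ModuleCat.{u} K} (hF : IsZero F) (x : ℕ) :
    IsZero (difference x F) := by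
  refine isZero_of_subsingleton_obj fun X => subsingleton_of_forall_eq 0 fun b => ?_
  obtain ⟨v, rfl⟩ := differenceProj_surjective x F X b
  have : Subsingleton (((translation x).obj F).obj X) := subsingleton_obj_of_isZero hF _
  rw [Subsingleton.elim v 0, map_zero]

end Difference

/-! ### Polynomial functors and the difference functor `δ_1` -/

section Vanishing

variable {K : Type u} [CommRing K]

/-- The `d`-fold difference functor `δ_1 ⋯ δ_1 F` is null. -/
def IterDifferenceVanishes : ℕ → (UBeta ⥤ ModuleCat.{u} K) → Prop
  | 0, F => IsZero F
  | d + 1, F => IterDifferenceVanishes d (difference 1 F)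

/-- Such sequences are stable under δ_1, so d applications reduce to the case where both outer terms
are null. -/
theorem iterDifferenceVanishes_of_isRightExact {d : ℕ} {P Q R : UBeta ⥤ ModuleCat.{u} K}
    {f : P ⟶ Q} {g : Q ⟶ R}
    (h : IsRightExact f g) (hP : IterDifferenceVanishes d P) (hR : IterDifferenceVanishes d R) :
    IterDifferenceVanishes d Q := by
  induction d generalizing P Q R with
  | zero => exact h.isZero hP hR
  | succ d ih => exact ih (isRightExact_differenceMap h 1) hP hR

theorem iterDifferenceVanishes_of_isZero {d : ℕ} {F : UBeta ⥤ ModuleCat.{u} K} (hF : IsZero F) :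
    IterDifferenceVanishes d F := by
  induction d generalizing F with
  | zero => exact hF
  | succ d ih => exact ih (isZero_difference hF 1)

theorem iterDifferenceVanishes_of_surjective {d : ℕ} {P Q : UBeta ⥤ ModuleCat.{u} K} (f : P ⟶ Q)
    (hf : ∀ X, Function.Surjective (f.app X)) (hP : IterDifferenceVanishes d P) :
    IterDifferenceVanishes d Q :=
  iterDifferenceVanishes_of_isRightExact (isRightExact_of_surjective f hf) hP
    (iterDifferenceVanishes_of_isZero (isZero_zero _))

end Vanishing

/-! ### The braiding of two copies of the object `1`, and iterated translations -/

namespace Braid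

theorem subsingleton_of_le_one {n : ℕ} (h : n ≤ 1) : Subsingleton (Braid n) := by
  refine subsingleton_of_forall_eq 1 fun g => ?_
  have : g ∈ (⊥ : Subgroup (Braid n)) :=
    PresentedGroup.generated_by (braidRels n) _ (fun i => absurd i.2 (by omega)) g
  exact this

/-- Naturality of the braiding in its first variable, for two strands:
`b_{2,m} ∘ (σ_1 ♮ id_m) = (id_m ♮ σ_1) ∘ b_{2,m}`. -/
theorem crossing_two_mul_gen (N m : ℕ) (h : m + 2 ≤ N) :
    crossing N 0 m 2 * gen N 0 = gen N m * crossing N 0 m 2 := by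
  -- Two strands cross `m` others. Enlarging `m` by one puts `gen N m * gen N (m + 1)` on the left
  -- of the product, up to a commutation, and the braid relation carries `gen N m` across it to `gen
  -- N (m + 1)`.
  have key : run N 0 m * run N 1 m * gen N 0 = gen N m * (run N 0 m * run N 1 m) := by
    induction m with
    | zero => simp [run]
    | succ m ih =>
      have h1 : run N 0 m * gen N (m + 1) = gen N (m + 1) * run N 0 m :=
        (commute_run N 0 m (m + 1) (Or.inl (by omega))).eq.symm
      have h2 := gen_braid N (i := m) (by omega)
      calc run N 0 (m + 1) * run N 1 (m + 1) * gen N 0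
          = gen N m * (run N 0 m * gen N (m + 1)) * run N 1 m * gen N 0 := by
            simp only [run, zero_add, add_comm 1 m, mul_assoc]
        _ = gen N m * gen N (m + 1) * (run N 0 m * run N 1 m * gen N 0) := by
            rw [h1]; simp only [mul_assoc]
        _ = (gen N m * gen N (m + 1) * gen N m) * run N 0 m * run N 1 m := by
            rw [ih (by omega)]; simp only [mul_assoc]
        _ = gen N (m + 1) * (gen N m * (gen N (m + 1) * run N 0 m) * run N 1 m) := by
            rw [h2]; simp only [mul_assoc]
        _ = gen N (m + 1) * (run N 0 (m + 1) * run N 1 (m + 1)) := by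
            rw [← h1]; simp only [run, zero_add, add_comm 1 m, mul_assoc]
  simpa [crossing] using key

end Braid

namespace UBeta

/-- `id_x ♮ (id_1 ♮ [n' - n, f])`, up to the identification of `x + (1 + n')` with
`(x + 1) + n'`. -/
theorem whiskerHom_whiskerHom_one (x : ℕ) {X Y : UBeta} (h : X.strands ≤ Y.strands)
    (f : Braid Y.strands) :
    whiskerHom x (whiskerHom 1 (bracket h f)) =
      bracket (X := ⟨x + (1 + X.strands)⟩) (Y := ⟨x + (1 + Y.strands)⟩) (by simpa using h)
        (Braid.shift (x + 1) (by omega) f *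
          (Braid.crossing (x + (1 + Y.strands)) 0 (Y.strands - X.strands) (x + 1))⁻¹) := by
  rw [whiskerHom_bracket, whiskerHom_bracket]
  congr 1
  rw [map_mul, map_inv, Braid.shift_shift, Braid.shift_crossing _ _ _ _ (by simp only; omega)]
  -- The recursion defining `crossing` splits off its last block, and for x + 1 strands that block
  -- is b_{1,n'-n} placed after x strands.
  simp only [Braid.crossing, Nat.add_sub_add_left, zero_add, add_zero, one_mul, mul_assoc,
    mul_inv_rev]

/-- The identification of `id_x ♮ (id_1 ♮ -)` with `id_{x+1} ♮ -`. -/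
def addLeftAssoc (x : ℕ) : addLeft 1 ⋙ addLeft x ≅ addLeft (x + 1) :=
  NatIso.ofComponents
    (fun X =>
      { hom := bracket (X := ⟨x + (1 + X.strands)⟩) (Y := ⟨x + 1 + X.strands⟩)
          (by simp only; omega) 1
        inv := bracket (Y := ⟨x + (1 + X.strands)⟩) (X := ⟨x + 1 + X.strands⟩)
          (by simp only; omega) 1
        hom_inv_id := by
          rw [bracket_comp_bracket, map_one, one_mul]; rfl
        inv_hom_id := by
          rw [bracket_comp_bracket, map_one, one_mul]; rfl })
    (fun {X Y} φ => by
      obtain ⟨h, f, rfl⟩ := exists_bracket φ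
      change whiskerHom x (whiskerHom 1 (bracket h f)) ≫ bracket _ _ =
        bracket _ _ ≫ whiskerHom (x + 1) (bracket h f)
      rw [whiskerHom_whiskerHom_one, whiskerHom_bracket, bracket_comp_bracket,
        bracket_comp_bracket, map_one, one_mul, mul_one]
      congr 1
      rw [map_mul, map_inv, Braid.shift_shift,
        Braid.shift_crossing _ _ _ _ (by simp only; omega)]
      congr 1
      · exact Braid.shift_congr (by simp only; omega) _ _ _
      · rw [show x + 1 + Y.strands - (x + (1 + Y.strands)) + 0 = 0 by omega])

theorem unitHom_comp_unitHom_comp_addLeftAssoc (x : ℕ) (X : UBeta) :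
    unitHom 1 X ≫ unitHom x ((addLeft 1).obj X) ≫ (addLeftAssoc x).hom.app X =
      unitHom (x + 1) X := by
  change bracket _ 1 ≫ bracket _ 1 ≫ bracket _ 1 = bracket _ 1
  rw [bracket_comp_bracket, bracket_comp_bracket]
  simp only [map_one, mul_one]

/-- The braid `(b_{1,1})⁻¹ ♮ id_n`. -/
def swapBraid (n : ℕ) : Braid (1 + (1 + n)) := (Braid.gen _ 0)⁻¹

/-- The natural automorphism `(b_{1,1})⁻¹ ♮ -` of `id_1 ♮ (id_1 ♮ -)`. -/
def addLeftSwap : addLeft 1 ⋙ addLeft 1 ≅ addLeft 1 ⋙ addLeft 1 :=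
  NatIso.ofComponents
    (fun X =>
      { hom := ofBraid (1 + (1 + X.strands)) (swapBraid X.strands)
        inv := ofBraid (1 + (1 + X.strands)) (swapBraid X.strands)⁻¹
        hom_inv_id := by rw [← ofBraid_mul, inv_mul_cancel]; rfl
        inv_hom_id := by rw [← ofBraid_mul, mul_inv_cancel]; rfl })
    (fun {X Y} φ => by
      obtain ⟨h, f, rfl⟩ := exists_bracket φ
      change whiskerHom 1 (whiskerHom 1 (bracket h f)) ≫ ofBraid _ _ =
        ofBraid _ _ ≫ whiskerHom 1 (whiskerHom 1 (bracket h f))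
      rw [whiskerHom_whiskerHom_one, bracket_comp_ofBraid, ofBraid, bracket_comp_bracket]
      congr 1
      -- With m = n' - n, the swap on the source becomes σ_{m+1}⁻¹. Passing it through b_{2,m}⁻¹
      -- turns it into σ_1⁻¹, which commutes with a braid placed after the first two strands.
      rw [swapBraid, swapBraid, map_inv, Braid.shift_gen _ _ (by simp only; omega), add_zero,
        Nat.add_sub_add_left, Nat.add_sub_add_left, mul_assoc, ← mul_inv_rev,
        ← Braid.crossing_two_mul_gen _ _ (by simp only; omega), mul_inv_rev, ← mul_assoc, ← mul_assoc]
      congr 1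
      refine (Commute.inv_left ?_).eq
      refine Braid.commute_of_gen (Braid.shift 2 _) _ (fun i hi => ?_) f
      rw [Braid.shift_gen _ _ hi]
      exact Braid.gen_comm _ (by omega))

/-- `id_1 ♮ (ι_1 ♮ id_n) = ((b_{1,1})⁻¹ ♮ id_n) ∘ (ι_1 ♮ id_{1+n})`. -/
theorem unitHom_comp_swap (X : UBeta) :
    unitHom 1 ((addLeft 1).obj X) ≫ addLeftSwap.hom.app X = (addLeft 1).map (unitHom 1 X) := by
  change bracket _ _ ≫ ofBraid (1 + (1 + X.strands)) (swapBraid X.strands) =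
    whiskerHom 1 (bracket (Y := ⟨1 + X.strands⟩) (Nat.le_add_left _ _) 1)
  rw [whiskerHom_bracket, map_one, one_mul, bracket_comp_ofBraid, mul_one]
  congr 1
  rw [swapBraid, show (1 + X.strands) - X.strands = 1 by omega]
  simp [Braid.crossing, Braid.run]

end UBeta

/-! ### Translations of polynomial functors, and reduction of all δ_x to δ_1 -/

section Translation

variable {K : Type u} [CommRing K]

/-- The isomorphism `τ_1 (τ_x F) ≅ τ_{x+1} F`. -/
def translationAssoc (x : ℕ) (F : UBeta ⥤ ModuleCat.{u} K) :
    (translation 1).obj ((translation x).obj F) ≅ (translation (x + 1)).obj F :=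
  Functor.isoWhiskerRight (UBeta.addLeftAssoc x) F

/-- The automorphism of `τ_1 (τ_1 F)` given by the braids `(b_{1,1})⁻¹ ♮ id_n`. -/
def translationSwap (F : UBeta ⥤ ModuleCat.{u} K) :
    (translation 1).obj ((translation 1).obj F) ≅ (translation 1).obj ((translation 1).obj F) :=
  Functor.isoWhiskerRight UBeta.addLeftSwap F

theorem surjective_app_of_isIso {C : Type*} [Category* C] {P Q : C ⥤ ModuleCat.{u} K} (f : P ⟶ Q)
    [IsIso f] (X : C) : Function.Surjective (f.app X) := surjective_app_of_epi f X

theorem surjective_app_comp {C : Type*} [Category* C] {P Q R : C ⥤ ModuleCat.{u} K} {f : P ⟶ Q}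
    {g : Q ⟶ R} {X : C} (hg : Function.Surjective (g.app X)) (hf : Function.Surjective (f.app X)) :
    Function.Surjective ((f ≫ g).app X) := hg.comp hf

theorem surjective_app_of_comp {C : Type*} [Category* C] {P Q R : C ⥤ ModuleCat.{u} K} {f : P ⟶ Q}
    {g : Q ⟶ R} {X : C} (h : Function.Surjective ((f ≫ g).app X)) :
    Function.Surjective (g.app X) := Function.Surjective.of_comp (g := f.app X) h

/-- The maps τ_1(i_1) and i_1 of τ_1 F insert the new strand at different places, and the swap of
the two first strands takes one to the other. It therefore descends to cokernels. -/
theorem exists_surjective_translation_difference (F : UBeta ⥤ ModuleCat.{u} K) :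
    ∃ v : (translation 1).obj (difference 1 F) ⟶ difference 1 ((translation 1).obj F),
      ∀ X, Function.Surjective (v.app X) := by
  obtain ⟨v, hv⟩ := exists_desc_of_surjective ((translation 1).map (differenceProj 1 F))
    ((translationSwap F).hom ≫ differenceProj 1 ((translation 1).obj F))
    (fun X => differenceProj_surjective 1 F _) (fun X a ha => by
      obtain ⟨w, rfl⟩ := (isRightExact_differenceProj 1 F _).2 a ha
      refine Eq.trans ?_ (differenceProj_app_translationUnit 1 ((translation 1).obj F) X w)
      change (differenceProj 1 ((translation 1).obj F)).app X
        ((F.map (UBeta.unitHom 1 _) ≫ F.map (UBeta.addLeftSwap.hom.app X)) w) = _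
      rw [← F.map_comp, UBeta.unitHom_comp_swap]
      rfl)
  refine ⟨v, fun X => surjective_app_of_comp (f := (translation 1).map (differenceProj 1 F)) ?_⟩
  rw [hv]
  exact surjective_app_comp (differenceProj_surjective _ _ X) (surjective_app_of_isIso _ X)

theorem IterDifferenceVanishes.translation {d : ℕ} {F : UBeta ⥤ ModuleCat.{u} K}
    (hF : IterDifferenceVanishes d F) : IterDifferenceVanishes d ((translation 1).obj F) := by
  induction d generalizing F with
  | zero => exact isZero_of_subsingleton_obj fun X => subsingleton_obj_of_isZero hF _
  | succ d ih =>
    obtain ⟨v, hv⟩ := exists_surjective_translation_difference F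
    exact iterDifferenceVanishes_of_surjective (d := d) v hv (ih hF)

/-- This is the sequence Coker(u) → Coker(v ∘ u) → Coker(v) → 0 for u = i_1 and v = τ_1(i_x), whose
composite is i_{x+1} up to the associativity isomorphism. -/
theorem exists_isRightExact_difference_succ (x : ℕ) (F : UBeta ⥤ ModuleCat.{u} K) :
    ∃ (f : difference 1 F ⟶ difference (x + 1) F)
      (g : difference (x + 1) F ⟶ (translation 1).obj (difference x F)), IsRightExact f g := by
  have hunit : ∀ X (v : F.obj X), (translationAssoc x F).hom.app X
      (((translation 1).map ((translationUnit x).app F)).app X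
        (((translationUnit 1).app F).app X v)) = ((translationUnit (x + 1)).app F).app X v := by
    intro X v
    change (F.map (UBeta.unitHom 1 X) ≫ F.map (UBeta.unitHom x _) ≫
      F.map ((UBeta.addLeftAssoc x).hom.app X)) v = F.map (UBeta.unitHom (x + 1) X) v
    rw [← F.map_comp, ← F.map_comp, UBeta.unitHom_comp_unitHom_comp_addLeftAssoc]
  obtain ⟨f, hf⟩ := exists_desc_difference (x := 1) (F := F)
    ((translation 1).map ((translationUnit x).app F) ≫ (translationAssoc x F).hom ≫
      differenceProj (x + 1) F) (fun X v =>
        (congrArg ((differenceProj (x + 1) F).app X) (hunit X v)).trans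
          (differenceProj_app_translationUnit _ _ _ _))
  have hinv : ∀ X v, (translationAssoc x F).inv.app X ((translationAssoc x F).hom.app X v) = v :=
    fun X v => LinearMap.congr_fun (congrArg ModuleCat.Hom.hom
      ((translationAssoc x F).hom_inv_id_app X)) v
  have hinv' : ∀ X v, (translationAssoc x F).hom.app X ((translationAssoc x F).inv.app X v) = v :=
    fun X v => LinearMap.congr_fun (congrArg ModuleCat.Hom.hom
      ((translationAssoc x F).inv_hom_id_app X)) v
  obtain ⟨g, hg⟩ := exists_desc_difference (x := x + 1) (F := F)
    ((translationAssoc x F).inv ≫ (translation 1).map (differenceProj x F)) (fun X v => by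
      rw [← hunit]
      exact (congrArg (((translation 1).map (differenceProj x F)).app X) (hinv X _)).trans
        (differenceProj_app_translationUnit x F _ _))
  refine ⟨f, g, fun X => ⟨surjective_app_of_comp (f := differenceProj (x + 1) F) ?_, ?_⟩⟩
  · rw [hg]
    exact surjective_app_comp (differenceProj_surjective x F _) (surjective_app_of_isIso _ X)
  · intro b hb
    obtain ⟨b, rfl⟩ := differenceProj_surjective (x + 1) F X b
    have hb' : ((translation 1).map (differenceProj x F)).app X
        ((translationAssoc x F).inv.app X b) = 0 :=
      (LinearMap.congr_fun (congrArg ModuleCat.Hom.hom (NatTrans.congr_app hg X)) b).symm.trans hb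
    obtain ⟨w, hw⟩ := (isRightExact_differenceProj x F _).2 _ hb'
    refine ⟨(differenceProj 1 F).app X w, ?_⟩
    refine (LinearMap.congr_fun (congrArg ModuleCat.Hom.hom (NatTrans.congr_app hf X)) w).trans ?_
    refine congrArg ((differenceProj (x + 1) F).app X) ?_
    exact (congrArg ((translationAssoc x F).hom.app X) hw).trans (hinv' X b)

theorem isZero_difference_zero (F : UBeta ⥤ ModuleCat.{u} K) : IsZero (difference 0 F) := by
  refine isZero_of_subsingleton_obj fun X => subsingleton_of_forall_eq 0 fun b => ?_
  obtain ⟨v, rfl⟩ := differenceProj_surjective 0 F X b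
  -- The objects 0 + n and n agree only propositionally, so the inverse of ι_0 ♮ id_n is written as
  -- the class of the identity braid.
  let j : (UBeta.addLeft 0).obj X ⟶ X :=
    UBeta.bracket (X := ⟨0 + X.strands⟩) (by simp only; omega) 1
  have hj : j ≫ UBeta.unitHom 0 X = 𝟙 _ := by
    change UBeta.bracket _ _ ≫ UBeta.bracket _ _ = UBeta.bracket _ _
    rw [UBeta.bracket_comp_bracket, map_one, one_mul]
  have hv : ((translationUnit 0).app F).app X (F.map j v) = v := by
    change (F.map j ≫ F.map (UBeta.unitHom 0 X)) v = v
    rw [← F.map_comp, hj, F.map_id]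
    rfl
  rw [← hv]
  exact differenceProj_app_translationUnit 0 F X _

theorem IterDifferenceVanishes.difference {d : ℕ} {F : UBeta ⥤ ModuleCat.{u} K}
    (hF : IterDifferenceVanishes (d + 1) F) (x : ℕ) :
    IterDifferenceVanishes d (difference x F) := by
  induction x with
  | zero => exact iterDifferenceVanishes_of_isZero (isZero_difference_zero F)
  | succ x ih =>
    obtain ⟨f, g, h⟩ := exists_isRightExact_difference_succ x F
    exact iterDifferenceVanishes_of_isRightExact h hF ih.translation

/-- The shift of index reflects that degree at most -1 means null, while `IsStrongPolynomial` starts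
at degree 0. -/
theorem isStrongPolynomial_iff_iterDifferenceVanishes {d : ℕ} {F : UBeta ⥤ ModuleCat.{u} K} :
    IsStrongPolynomial d F ↔ IterDifferenceVanishes (d + 1) F := by
  induction d generalizing F with
  | zero => exact ⟨fun h => h 1, fun h x => h.difference x⟩
  | succ d ih => exact ⟨fun h => ih.mp (h 1), fun h x => ih.mpr (h.difference x)⟩

end Translation

/-! ### Tensor products with the augmentation ideal of a free group -/

section FreeAugTensor

variable {K : Type u} [CommRing K]

/-- The element `g - 1` of the augmentation ideal. -/
noncomputable def augIdealOf {G : Type*} [Group G] (g : G) : augIdeal K G :=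
  ⟨MonoidAlgebra.single g 1 - 1, by
    rw [mem_augIdeal, map_sub, sub_eq_zero, MonoidAlgebra.lift_single,
      map_one (MonoidAlgebra.lift K K G (1 : G →* K))]; simp⟩

theorem augIdealMap_of {G H : Type*} [Group G] [Group H] (f : G →* H) (g : G) :
    augIdealMap f (augIdealOf g : augIdeal K G) = augIdealOf (f g) := by
  ext1
  rw [coe_augIdealMap, augIdealOf, augIdealOf, map_sub, map_one]
  simp

/-- The expression x - ε(x) · 1, with ε the augmentation, is linear in x, equals c (g - 1) on a
monomial c g, and equals x on the augmentation ideal. -/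
theorem span_augIdealOf (G : Type*) [Group G] :
    Submodule.span K (Set.range (augIdealOf : G → augIdeal K G)) = ⊤ := by
  refine Submodule.eq_top_iff'.mpr fun i => ?_
  have hmem : ∀ x : MonoidAlgebra K G, x - MonoidAlgebra.lift K K G (1 : G →* K) x • 1 ∈
      (Submodule.span K (Set.range (augIdealOf : G → augIdeal K G))).map (augIdeal K G).subtype := by
    intro x
    induction x using MonoidAlgebra.induction_linear with
    | zero => simp
    | add x y hx hy =>
      rw [map_add, add_smul, add_sub_add_comm]
      exact add_mem hx hy
    | single g c =>
      refine ⟨c • augIdealOf g, Submodule.smul_mem _ _ (Submodule.subset_span ⟨g, rfl⟩), ?_⟩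
      simp [augIdealOf, smul_sub]
  obtain ⟨j, hj, hji⟩ := hmem i
  rw [mem_augIdeal.mp i.2, zero_smul, sub_zero] at hji
  rwa [← Subtype.ext hji]

namespace AugTensor

section Group

variable {G : Type} [Group G] {M : Type u} [AddCommGroup M] [Module K M]
  (ρ : Representation K G M)

/-- The linear map `v ↦ (g - 1) ⊗ v`. -/
noncomputable def single (g : G) : M →ₗ[K] AugTensor ρ :=
  (augTensorRel ρ).mkQ ∘ₗ TensorProduct.mk K (augIdeal K G) M (augIdealOf g)

theorem single_apply (g : G) (v : M) : single ρ g v = tmul ρ (augIdealOf g) v := rfl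

theorem tmul_mul (i : augIdeal K G) (r : MonoidAlgebra K G) (v : M) :
    tmul ρ (augIdealMul i r) v = tmul ρ i (ρ.asAlgebraHom r v) :=
  (Submodule.Quotient.eq _).mpr (Submodule.subset_span ⟨i, r, v, rfl⟩)

theorem single_one : single ρ 1 = 0 := by
  ext v
  have : (augIdealOf (1 : G) : augIdeal K G) = 0 := by
    ext1
    exact sub_self _
  rw [single_apply, this]
  exact (congrArg (augTensorRel ρ).mkQ (TensorProduct.zero_tmul _ v)).trans (map_zero _)

/-- This is the crossed-homomorphism rule gh - 1 = (g - 1) h + (h - 1), with h moved across the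
tensor sign. -/
theorem single_mul (g h : G) (v : M) :
    single ρ (g * h) v = single ρ g (ρ h v) + single ρ h v := by
  have : (augIdealOf (g * h) : augIdeal K G) =
      augIdealMul (augIdealOf g) (MonoidAlgebra.single h 1) + augIdealOf h := by
    ext1
    change _ = (MonoidAlgebra.single g 1 - 1) * MonoidAlgebra.single h 1 +
      (MonoidAlgebra.single h 1 - 1)
    rw [sub_mul, one_mul, MonoidAlgebra.single_mul_single, mul_one, sub_add_sub_cancel]
    rfl
  rw [single_apply, this, single_apply, single_apply,
    show ρ h v = ρ.asAlgebraHom (MonoidAlgebra.single h 1) v by simp, ← tmul_mul]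
  exact (congrArg (augTensorRel ρ).mkQ (TensorProduct.add_tmul _ _ v)).trans (map_add _ _ _)

theorem hom_ext_single {P : Type*} [AddCommGroup P] [Module K P] {s t : AugTensor ρ →ₗ[K] P}
    (h : ∀ g v, s (single ρ g v) = t (single ρ g v)) : s = t := by
  refine hom_ext fun i v => ?_
  have hi : i ∈ Submodule.span K (Set.range (augIdealOf : G → augIdeal K G)) := by
    rw [span_augIdealOf]; trivial
  let T : augIdeal K G →ₗ[K] AugTensor ρ := (augTensorRel ρ).mkQ ∘ₗ
    (TensorProduct.mk K (augIdeal K G) M).flip v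
  have : Set.EqOn (s ∘ₗ T) (t ∘ₗ T) (Submodule.span K (Set.range (augIdealOf : G → augIdeal K G)) :
      Set (augIdeal K G)) := by
    refine LinearMap.eqOn_span ?_
    rintro _ ⟨g, rfl⟩
    exact h g v
  exact this hi

theorem map_single {H : Type} [Group H] {N : Type u} [AddCommGroup N] [Module K N]
    (ρ' : Representation K H N) (f : G →* H) (φ : M →ₗ[K] N)
    (hφ : ∀ g v, φ (ρ g v) = ρ' (f g) (φ v)) (g : G) (v : M) :
    map ρ ρ' f φ hφ (single ρ g v) = single ρ' (f g) (φ v) := by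
  rw [single_apply, map_tmul, augIdealMap_of]
  rfl

theorem subsingleton [Subsingleton M] : Subsingleton (AugTensor ρ) := by
  have : LinearMap.id (R := K) (M := AugTensor ρ) = 0 := hom_ext_single ρ fun g v => by
    rw [Subsingleton.elim v 0, map_zero, map_zero, map_zero]
  exact subsingleton_of_forall_eq 0 fun z => LinearMap.congr_fun this z

end Group

/-! ### Free groups: the augmentation ideal is free on the elements x - 1 -/

section FreeGroup

variable {S : Type} {M : Type u} [AddCommGroup M] [Module K M]
  (ρ : Representation K (FreeGroup S) M) {P : Type*} [AddCommGroup P] [Module K P]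

/-- Linear maps out of `I ⊗ M`, for the augmentation ideal `I` of a free group, are determined by
their values on the elements `(s - 1) ⊗ v` for generators `s`. -/
theorem hom_ext_of {s t : AugTensor ρ →ₗ[K] P}
    (h : ∀ x v, s (single ρ (.of x) v) = t (single ρ (.of x) v)) : s = t := by
  refine hom_ext_single ρ fun g => ?_
  induction g using FreeGroup.induction_on with
  | C1 => simp [single_one]
  | of x => exact h x
  | inv_of x hx =>
    intro v
    -- Apply `single_mul` to x x⁻¹ = 1.
    have key : single ρ (FreeGroup.of x)⁻¹ v =
        -single ρ (.of x) (ρ (FreeGroup.of x)⁻¹ v) := by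
      rw [eq_neg_iff_add_eq_zero, add_comm, ← single_mul, mul_inv_cancel, single_one]
      rfl
    rw [key, map_neg, map_neg, h]
  | mul g g' hg hg' =>
    intro v
    rw [single_mul, map_add, map_add, hg, hg']

/-- The automorphism `(p, v) ↦ (p + f v, g v)` of `P × M`. -/
def shear (f : M →ₗ[K] P) (g : FreeGroup S) : (P × M) ≃ₗ[K] (P × M) :=
  LinearEquiv.ofLinearMap
    ((LinearMap.fst K P M + f ∘ₗ LinearMap.snd K P M).prod (ρ g ∘ₗ LinearMap.snd K P M))
    ((LinearMap.fst K P M - f ∘ₗ ρ g⁻¹ ∘ₗ LinearMap.snd K P M).prod (ρ g⁻¹ ∘ₗ LinearMap.snd K P M))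
    (by ext <;> simp) (by ext <;> simp)

/-- The action of the free group on `P × M` for which the generator `s` sends `(p, v)` to
`(p + f_s v, s v)`. -/
noncomputable def shearRep (f : S → M →ₗ[K] P) : Representation K (FreeGroup S) (P × M) :=
  (LinearEquiv.automorphismGroup.toLinearMapMonoidHom (R := K) (M := P × M)).comp
    (FreeGroup.lift fun s => shear ρ (f s) (.of s))

theorem shearRep_of (f : S → M →ₗ[K] P) (s : S) (z : P × M) :
    shearRep ρ f (.of s) z = (z.1 + f s z.2, ρ (.of s) z.2) := by
  change (FreeGroup.lift (fun s => shear ρ (f s) (.of s)) (.of s) : (P × M) ≃ₗ[K] (P × M)) z = _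
  rw [FreeGroup.lift_apply_of]
  rfl

/-- The action is block triangular: P is a subrepresentation with trivial action and the quotient is
M. The off-diagonal block is the crossed homomorphism with prescribed values `f s`, as in Fox
calculus. -/
theorem shearRep_inl (f : S → M →ₗ[K] P) (g : FreeGroup S) (p : P) :
    shearRep ρ f g (p, 0) = (p, 0) := by
  induction g using FreeGroup.induction_on with
  | C1 => simp
  | of s => simp [shearRep_of]
  | inv_of s hs =>
    conv_lhs => rw [← hs]
    rw [← Module.End.mul_apply, ← map_mul, inv_mul_cancel, map_one, Module.End.one_apply]
  | mul g h hg hh => rw [map_mul, Module.End.mul_apply, hh, hg]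

theorem shearRep_snd (f : S → M →ₗ[K] P) (g : FreeGroup S) (z : P × M) :
    (shearRep ρ f g z).2 = ρ g z.2 := by
  induction g using FreeGroup.induction_on generalizing z with
  | C1 => simp
  | of s => simp [shearRep_of]
  | inv_of s hs =>
    have := hs (shearRep ρ f (FreeGroup.of s)⁻¹ z)
    rw [← Module.End.mul_apply, ← map_mul, mul_inv_cancel, map_one, Module.End.one_apply] at this
    rw [this, ← Module.End.mul_apply, ← map_mul, inv_mul_cancel, map_one, Module.End.one_apply]
  | mul g h hg hh =>
    rw [map_mul, Module.End.mul_apply, hg, hh, map_mul, Module.End.mul_apply]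

theorem asAlgebraHom_shearRep_inl (f : S → M →ₗ[K] P) (r : MonoidAlgebra K (FreeGroup S)) (p : P) :
    (shearRep ρ f).asAlgebraHom r (p, 0) =
      MonoidAlgebra.lift K K (FreeGroup S) (1 : FreeGroup S →* K) r • (p, 0) := by
  induction r using MonoidAlgebra.induction_linear with
  | zero => simp
  | add x y hx hy => rw [map_add, map_add, add_smul, LinearMap.add_apply, hx, hy]
  | single g c => simp [shearRep_inl]

theorem asAlgebraHom_shearRep_snd (f : S → M →ₗ[K] P) (r : MonoidAlgebra K (FreeGroup S))
    (z : P × M) : ((shearRep ρ f).asAlgebraHom r z).2 = ρ.asAlgebraHom r z.2 := by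
  induction r using MonoidAlgebra.induction_linear with
  | zero => simp
  | add x y hx hy => simp only [map_add, LinearMap.add_apply, Prod.snd_add, hx, hy]
  | single g c => simp [shearRep_snd]

/-- The linear map out of `I ⊗ M`, for the augmentation ideal `I` of a free group, with the values
`f_s v` on `(s - 1) ⊗ v` for generators `s`. -/
noncomputable def lift (f : S → M →ₗ[K] P) : AugTensor ρ →ₗ[K] P :=
  (augTensorRel ρ).liftQ
    (TensorProduct.lift (LinearMap.mk₂ K
      (fun (i : augIdeal K (FreeGroup S)) (v : M) =>
        -- The off-diagonal block of `i`; at i = s - 1 it is `f s v`.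
        ((shearRep ρ f).asAlgebraHom i.1 ((0 : P), v)).1)
      (fun i j v => by simp) (fun c i v => by simp)
      (fun i v w => by
        rw [← Prod.fst_add, ← map_add, Prod.mk_add_mk, add_zero])
      (fun c i v => by
        rw [← Prod.smul_fst, ← map_smul, Prod.smul_mk, smul_zero])))
    (by
      refine Submodule.span_le.mpr ?_
      rintro _ ⟨i, r, v, rfl⟩
      change TensorProduct.lift _ _ = 0
      rw [map_sub, TensorProduct.lift.tmul, TensorProduct.lift.tmul, LinearMap.mk₂_apply,
        LinearMap.mk₂_apply, sub_eq_zero]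
      change ((shearRep ρ f).asAlgebraHom (i.1 * r) (0, v)).1 = _
      rw [map_mul, Module.End.mul_apply]
      -- Balancedness: r (0, v) differs from (0, r v) by an element of P, which the augmentation
      -- ideal kills because P is trivial.
      have : (shearRep ρ f).asAlgebraHom r ((0 : P), v) =
          (((shearRep ρ f).asAlgebraHom r ((0 : P), v)).1, 0) + (0, ρ.asAlgebraHom r v) := by
        rw [Prod.mk_add_mk, add_zero, zero_add]
        exact Prod.ext rfl (asAlgebraHom_shearRep_snd ρ f r _)
      rw [this, map_add, asAlgebraHom_shearRep_inl, mem_augIdeal.mp i.2, zero_smul, zero_add])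

theorem lift_single_of (f : S → M →ₗ[K] P) (s : S) (v : M) :
    lift ρ f (single ρ (.of s) v) = f s v := by
  change ((shearRep ρ f).asAlgebraHom (MonoidAlgebra.single (FreeGroup.of s) 1 - 1)
    ((0 : P), v)).1 = f s v
  simp [shearRep_of]

/-- Tensoring with the augmentation ideal of a free group is exact. -/
theorem exists_of_map_eq_zero {M₁ M₂ M₃ : Type u} [AddCommGroup M₁] [Module K M₁]
    [AddCommGroup M₂] [Module K M₂] [AddCommGroup M₃] [Module K M₃]
    (ρ₁ : Representation K (FreeGroup S) M₁) (ρ₂ : Representation K (FreeGroup S) M₂)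
    (ρ₃ : Representation K (FreeGroup S) M₃) (φ : M₁ →ₗ[K] M₂) (ψ : M₂ →ₗ[K] M₃)
    (hφ : ∀ g v, φ (ρ₁ g v) = ρ₂ (MonoidHom.id _ g) (φ v))
    (hψ : ∀ g v, ψ (ρ₂ g v) = ρ₃ (MonoidHom.id _ g) (ψ v))
    (hs : Function.Surjective ψ) (he : ∀ v, ψ v = 0 → ∃ w, φ w = v) (z : AugTensor ρ₂)
    (hz : map ρ₂ ρ₃ (MonoidHom.id _) ψ hψ z = 0) :
    ∃ y, map ρ₁ ρ₂ (MonoidHom.id _) φ hφ y = z := by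
  -- The quotient map by the image `N` is shown to factor through I ⊗ M₃, so it kills `z`. By
  -- freeness the factorisation may be prescribed on each generator separately, where it exists
  -- because ker ψ lies in the image of φ.
  let N := LinearMap.range (map ρ₁ ρ₂ (MonoidHom.id _) φ hφ)
  let q (s : S) : M₂ →ₗ[K] AugTensor ρ₂ ⧸ N := N.mkQ ∘ₗ single ρ₂ (.of s)
  have hq (s : S) : LinearMap.ker ψ ≤ LinearMap.ker (q s) := by
    intro v hv
    obtain ⟨w, rfl⟩ := he v hv
    refine (Submodule.Quotient.mk_eq_zero N).mpr ⟨single ρ₁ (.of s) w, ?_⟩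
    rw [map_single]
    rfl
  let f (s : S) : M₃ →ₗ[K] AugTensor ρ₂ ⧸ N :=
    (LinearMap.ker ψ).liftQ (q s) (hq s) ∘ₗ (ψ.quotKerEquivOfSurjective hs).symm.toLinearMap
  have hf (s : S) (v : M₂) : f s (ψ v) = q s v := by
    have : (ψ.quotKerEquivOfSurjective hs).symm (ψ v) = Submodule.Quotient.mk v :=
      (LinearEquiv.symm_apply_eq _).mpr rfl
    change (LinearMap.ker ψ).liftQ (q s) (hq s) ((ψ.quotKerEquivOfSurjective hs).symm (ψ v)) = _
    rw [this]
    rfl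
  have hcomp : lift ρ₃ f ∘ₗ map ρ₂ ρ₃ (MonoidHom.id _) ψ hψ = N.mkQ := by
    refine hom_ext_of ρ₂ fun s v => ?_
    rw [LinearMap.comp_apply, map_single, MonoidHom.id_apply, lift_single_of, hf]
    rfl
  have := LinearMap.congr_fun hcomp z
  rw [LinearMap.comp_apply, hz, map_zero] at this
  exact (Submodule.Quotient.mk_eq_zero N).mp this.symm

theorem map_surjective {G : Type} [Group G] {M₂ M₃ : Type u} [AddCommGroup M₂] [Module K M₂]
    [AddCommGroup M₃] [Module K M₃] (ρ₂ : Representation K G M₂) (ρ₃ : Representation K G M₃)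
    (ψ : M₂ →ₗ[K] M₃) (hψ : ∀ g v, ψ (ρ₂ g v) = ρ₃ (MonoidHom.id _ g) (ψ v))
    (hs : Function.Surjective ψ) : Function.Surjective (map ρ₂ ρ₃ (MonoidHom.id _) ψ hψ) := by
  rw [← LinearMap.range_eq_top, ← Submodule.ker_mkQ (LinearMap.range _), LinearMap.ker_eq_top]
  refine hom_ext_single ρ₃ fun g v => ?_
  obtain ⟨v, rfl⟩ := hs v
  exact (Submodule.Quotient.mk_eq_zero _).mpr ⟨single ρ₂ g v, map_single ρ₂ ρ₃ _ ψ hψ g v⟩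

end FreeGroup

end AugTensor

end FreeAugTensor

/-! ### The difference of a Long-Moody functor -/

namespace UBeta

/-- Endomorphisms of `1 + n` are determined by their restrictions along `ι_1 ♮ id_n`. -/
theorem unitHom_one_cancel {X : UBeta} {p q : (addLeft 1).obj X ⟶ (addLeft 1).obj X}
    (h : unitHom 1 X ≫ p = unitHom 1 X ≫ q) : p = q := by
  obtain ⟨_, f, rfl⟩ := exists_bracket p
  obtain ⟨_, g, rfl⟩ := exists_bracket q
  change bracket _ _ ≫ bracket _ _ = bracket _ _ ≫ bracket _ _ at h
  rw [bracket_comp_bracket, bracket_comp_bracket, bracket_eq_iff] at h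
  obtain ⟨w, hw⟩ := h
  -- The two composites agree up to a braid on a single strand, and that group is trivial.
  have := Braid.subsingleton_of_le_one
    (n := (⟨1 + X.strands⟩ : UBeta).strands - X.strands) (by simp only; omega)
  rw [Subsingleton.elim w 1, map_one, mul_one, map_one, mul_one, mul_one] at hw
  rw [hw]

end UBeta

section LongMoodyDifference

variable {K : Type u} [CommRing K] {a : ∀ n : ℕ, Braid n →* MulAut (FreeGroup (Fin n))}
  {ς : ∀ n : ℕ, FreeGroup (Fin n) →* Braid (1 + n)}

theorem freeAction_unitHom_of (hc : IsCoherent a ς) (X : UBeta) (s : Fin X.strands) :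
    freeAction hc (UBeta.unitHom 1 X) (.of s) =
      FreeGroup.of (⟨1 + s, by omega⟩ : Fin (1 + X.strands)) := by
  rw [UBeta.unitHom, freeAction_bracket, map_one, MulAut.one_apply, freeLast, FreeGroup.map.of]
  congr 2
  simp only
  omega

/-- The action of `id_1 ♮ φ` fixes the first generator. -/
theorem freeAction_addLeft_of_zero (hc : IsCoherent a ς) (hr : IsReliable a) {X Y : UBeta}
    (φ : X ⟶ Y) :
    freeAction hc ((UBeta.addLeft 1).map φ)
        (FreeGroup.of (⟨0, by omega⟩ : Fin (1 + X.strands))) =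
      FreeGroup.of (⟨0, by omega⟩ : Fin (1 + Y.strands)) := by
  obtain ⟨h, σ, rfl⟩ := UBeta.exists_bracket φ
  have h1 := hr.braiding X.strands Y.strands h (.of 0)
  have h2 := hr.stabilizer Y.strands (1 + Y.strands) (Nat.le_add_left _ _) σ
    (.of ⟨0, by omega⟩)
  rw [map_inv, Braid.braiding, Braid.shift_crossing _ _ _ _ (by omega)] at h1
  change freeAction hc (UBeta.whiskerHom 1 (UBeta.bracket h σ)) _ = _
  rw [UBeta.whiskerHom_bracket, freeAction_bracket, map_mul, MulAut.mul_apply]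
  -- The factor b_{1,n'-n}⁻¹ ♮ id_n takes the shifted first generator back to the first place, and
  -- id_1 ♮ σ leaves it there.
  refine Eq.trans (congrArg _ h1) (Eq.trans ?_ h2)
  rw [Braid.shift_congr (k := 1) (l := 1 + Y.strands - Y.strands) (by omega) _ (by omega)]
  rfl

/-- This makes the swap equivariant, so that LM(τ_1 F) → τ_1(LM F) is defined. After precomposition
with ι_1 ♮ id it becomes the equivariance of id_1 ♮ (ι_1 ♮ id_n), a consequence of coherence; no
information is lost by `unitHom_one_cancel`. -/
theorem swap_equivariant (hc : IsCoherent a ς) (X : UBeta) (g : FreeGroup (Fin X.strands)) :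
    (UBeta.addLeft 1).map (UBeta.ofBraid (1 + X.strands) (ς X.strands g)) ≫
        UBeta.addLeftSwap.hom.app X =
      UBeta.addLeftSwap.hom.app X ≫ UBeta.ofBraid (1 + (1 + X.strands))
        (ς (1 + X.strands) (freeAction hc (UBeta.unitHom 1 X) g)) := by
  have h := freeAction_equivariant hc (UBeta.unitHom 1 X) g
  rw [← UBeta.unitHom_comp_swap, ← Category.assoc] at h
  refine UBeta.unitHom_one_cancel (X := ⟨1 + X.strands⟩)
    (Eq.trans ?_ (h.trans (Category.assoc _ _ _)))
  exact ((Category.assoc _ _ _).symm.trans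
    (congrArg (· ≫ UBeta.addLeftSwap.hom.app X) (UBeta.unitHom_naturality 1 _).symm))

theorem app_freeRep {F G : UBeta ⥤ ModuleCat.{u} K} (η : F ⟶ G) (n : ℕ) (g : FreeGroup (Fin n))
    (v : F.obj ⟨1 + n⟩) :
    (η.app ⟨1 + n⟩).hom (freeRep ς F n g v) =
      freeRep ς G n (MonoidHom.id _ g) ((η.app ⟨1 + n⟩).hom v) :=
  LinearMap.congr_fun (congrArg ModuleCat.Hom.hom (η.naturality _)) v

theorem map_freeRep (hc : IsCoherent a ς) (F : UBeta ⥤ ModuleCat.{u} K) {X Y : UBeta} (φ : X ⟶ Y)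
    (g : FreeGroup (Fin X.strands)) (v : F.obj ⟨1 + X.strands⟩) :
    (F.map ((UBeta.addLeft 1).map φ)).hom (freeRep ς F X.strands g v) =
      freeRep ς F Y.strands (freeAction hc φ g) ((F.map ((UBeta.addLeft 1).map φ)).hom v) := by
  have := congrArg F.map (freeAction_equivariant hc φ g)
  rw [F.map_comp, F.map_comp] at this
  exact LinearMap.congr_fun (congrArg ModuleCat.Hom.hom this) v

theorem longMoody_map_app_single (hc : IsCoherent a ς) {F G : UBeta ⥤ ModuleCat.{u} K} (η : F ⟶ G)
    (X : UBeta) (g : FreeGroup (Fin X.strands)) (v : F.obj ⟨1 + X.strands⟩) :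
    ((longMoody hc).map η).app X (AugTensor.single (freeRep ς F X.strands) g v) =
      AugTensor.single (freeRep ς G X.strands) g (η.app ⟨1 + X.strands⟩ v) :=
  AugTensor.map_single _ _ (MonoidHom.id _) _ (app_freeRep η X.strands) g v

theorem longMoody_obj_map_single (hc : IsCoherent a ς) (F : UBeta ⥤ ModuleCat.{u} K) {X Y : UBeta}
    (φ : X ⟶ Y) (g : FreeGroup (Fin X.strands)) (v : F.obj ⟨1 + X.strands⟩) :
    ((longMoody hc).obj F).map φ (AugTensor.single (freeRep ς F X.strands) g v) =
      AugTensor.single (freeRep ς F Y.strands) (freeAction hc φ g)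
        (F.map ((UBeta.addLeft 1).map φ) v) :=
  AugTensor.map_single _ _ _ _ (map_freeRep hc F φ) g v

/-- The component of `LM(τ_1 F) → τ_1 (LM F)`. -/
noncomputable def longMoodyTranslationApp (hc : IsCoherent a ς) (F : UBeta ⥤ ModuleCat.{u} K)
    (X : UBeta) :
    AugTensor (freeRep ς ((translation 1).obj F) X.strands) →ₗ[K]
      AugTensor (freeRep ς F (1 + X.strands)) :=
  AugTensor.map _ _ (freeAction hc (UBeta.unitHom 1 X)) ((translationSwap F).hom.app X).hom
    (fun g v => by
      have := congrArg F.map (swap_equivariant hc X g)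
      rw [F.map_comp, F.map_comp] at this
      exact LinearMap.congr_fun (congrArg ModuleCat.Hom.hom this) v)

theorem longMoodyTranslationApp_single (hc : IsCoherent a ς) (F : UBeta ⥤ ModuleCat.{u} K)
    (X : UBeta) (g : FreeGroup (Fin X.strands)) (v : ((translation 1).obj F).obj ⟨1 + X.strands⟩) :
    longMoodyTranslationApp hc F X
        (AugTensor.single (freeRep ς ((translation 1).obj F) X.strands) g v) =
      AugTensor.single (freeRep ς F (1 + X.strands)) (freeAction hc (UBeta.unitHom 1 X) g)
        ((translationSwap F).hom.app X v) :=
  AugTensor.map_single _ _ _ _ _ g v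

/-- The morphism `LM(τ_1 F) → τ_1 (LM F)`, `i ⊗ v ↦ (ι * id)(i) ⊗ F((b_{1,1})⁻¹ ♮ id_n)(v)`. -/
noncomputable def longMoodyTranslation (hc : IsCoherent a ς) (F : UBeta ⥤ ModuleCat.{u} K) :
    (longMoody hc).obj ((translation 1).obj F) ⟶ (translation 1).obj ((longMoody hc).obj F) where
  app X := ModuleCat.ofHom (longMoodyTranslationApp hc F X)
  naturality X Y φ := by
    ext1
    refine AugTensor.hom_ext_single _ fun g v => ?_
    change longMoodyTranslationApp hc F Y (((longMoody hc).obj ((translation 1).obj F)).map φ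
        (AugTensor.single (freeRep ς ((translation 1).obj F) X.strands) g v)) =
      ((longMoody hc).obj F).map ((UBeta.addLeft 1).map φ) (longMoodyTranslationApp hc F X
        (AugTensor.single (freeRep ς ((translation 1).obj F) X.strands) g v))
    rw [longMoody_obj_map_single, longMoodyTranslationApp_single, longMoodyTranslationApp_single]
    refine Eq.trans ?_ (longMoody_obj_map_single hc F ((UBeta.addLeft 1).map φ) _ _).symm
    refine congrArg₂ (fun g v => AugTensor.single (freeRep ς F (1 + Y.strands)) g v) ?_ ?_
    · rw [← MonoidHom.comp_apply, ← freeAction_comp, UBeta.unitHom_naturality, freeAction_comp]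
      rfl
    · exact LinearMap.congr_fun (congrArg ModuleCat.Hom.hom
        ((translationSwap F).hom.naturality φ)) v

/-- The image of i_1 avoids the first generator: i_1 of LM(F) factors through LM(τ_1 F), by the same
relation between swap and unit as for translations. -/
theorem longMoodyTranslation_app_map_translationUnit (hc : IsCoherent a ς)
    (F : UBeta ⥤ ModuleCat.{u} K) (X : UBeta) (z : ((longMoody hc).obj F).obj X) :
    (longMoodyTranslation hc F).app X
        (((longMoody hc).map ((translationUnit 1).app F)).app X z) =
      ((translationUnit 1).app ((longMoody hc).obj F)).app X z := by
  have : (longMoodyTranslationApp hc F X) ∘ₗ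
      (((longMoody hc).map ((translationUnit 1).app F)).app X).hom =
      (((longMoody hc).obj F).map (UBeta.unitHom 1 X)).hom := by
    refine AugTensor.hom_ext_single _ fun g v => ?_
    change longMoodyTranslationApp hc F X (((longMoody hc).map ((translationUnit 1).app F)).app X
        (AugTensor.single (freeRep ς F X.strands) g v)) =
      ((longMoody hc).obj F).map (UBeta.unitHom 1 X) (AugTensor.single (freeRep ς F X.strands) g v)
    refine (congrArg (longMoodyTranslationApp hc F X)
      (longMoody_map_app_single hc ((translationUnit 1).app F) X g v)).trans ?_
    rw [longMoodyTranslationApp_single]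
    refine Eq.trans ?_ (longMoody_obj_map_single hc F (UBeta.unitHom 1 X) g v).symm
    refine congrArg (AugTensor.single (freeRep ς F (1 + X.strands)) _) ?_
    change (F.map (UBeta.unitHom 1 _) ≫ F.map (UBeta.addLeftSwap.hom.app X)) v = _
    rw [← F.map_comp, UBeta.unitHom_comp_swap]
  exact LinearMap.congr_fun this z

/-- The component on the first generator, `τ_1 (LM F)(n) → F(1 + (1 + n))`. -/
noncomputable def firstComponentApp (ς : ∀ n : ℕ, FreeGroup (Fin n) →* Braid (1 + n))
    (F : UBeta ⥤ ModuleCat.{u} K) (X : UBeta) :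
    AugTensor (freeRep ς F (1 + X.strands)) →ₗ[K] F.obj ⟨1 + (1 + X.strands)⟩ :=
  AugTensor.lift (freeRep ς F (1 + X.strands)) fun j : Fin (1 + X.strands) =>
    if (j : ℕ) = 0 then (LinearMap.id : F.obj ⟨1 + (1 + X.strands)⟩ →ₗ[K] _) else 0

theorem firstComponentApp_single_zero (F : UBeta ⥤ ModuleCat.{u} K) (X : UBeta)
    (v : F.obj ⟨1 + (1 + X.strands)⟩) :
    firstComponentApp ς F X (AugTensor.single (freeRep ς F (1 + X.strands))
      (.of ⟨0, by omega⟩) v) = v := by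
  rw [firstComponentApp, AugTensor.lift_single_of, if_pos rfl, LinearMap.id_apply]

theorem firstComponentApp_single_of_ne (F : UBeta ⥤ ModuleCat.{u} K) (X : UBeta)
    {j : Fin (1 + X.strands)} (hj : (j : ℕ) ≠ 0) (v : F.obj ⟨1 + (1 + X.strands)⟩) :
    firstComponentApp ς F X (AugTensor.single (freeRep ς F (1 + X.strands)) (.of j) v) = 0 := by
  rw [firstComponentApp, AugTensor.lift_single_of, if_neg hj, LinearMap.zero_apply]

theorem firstComponentApp_longMoodyTranslationApp (hc : IsCoherent a ς)
    (F : UBeta ⥤ ModuleCat.{u} K) (X : UBeta)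
    (z : AugTensor (freeRep ς ((translation 1).obj F) X.strands)) :
    firstComponentApp ς F X (longMoodyTranslationApp hc F X z) = 0 := by
  have : firstComponentApp ς F X ∘ₗ longMoodyTranslationApp hc F X = 0 := by
    refine AugTensor.hom_ext_of _ fun s v => ?_
    rw [LinearMap.comp_apply, longMoodyTranslationApp_single, freeAction_unitHom_of]
    exact firstComponentApp_single_of_ne F X (by simp only; omega) _
  exact LinearMap.congr_fun this z

/-- The generators of `τ_1 (LM F)(n)`. -/
theorem single_of_cases (hc : IsCoherent a ς) (F : UBeta ⥤ ModuleCat.{u} K) (X : UBeta)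
    (j : Fin (1 + X.strands)) (v : F.obj ⟨1 + (1 + X.strands)⟩) :
    j = ⟨0, by omega⟩ ∨ ∃ s w, longMoodyTranslationApp hc F X
        (AugTensor.single (freeRep ς ((translation 1).obj F) X.strands) (.of s) w) =
      AugTensor.single (freeRep ς F (1 + X.strands)) (.of j) v := by
  obtain ⟨j, hj⟩ := j
  rcases j with _ | j
  · exact Or.inl rfl
  · refine Or.inr ⟨⟨j, by omega⟩, (translationSwap F).inv.app X v, ?_⟩
    have : (translationSwap F).hom.app X ((translationSwap F).inv.app X v) = v :=
      LinearMap.congr_fun (congrArg ModuleCat.Hom.hom ((translationSwap F).inv_hom_id_app X)) v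
    refine (longMoodyTranslationApp_single hc F X _ _).trans ?_
    refine congrArg₂ (fun g v => AugTensor.single (freeRep ς F (1 + X.strands)) g v) ?_ this
    rw [freeAction_unitHom_of]
    simp only [add_comm]

/-- The morphism `τ_1 (LM F) → τ_1 (τ_1 F)` given by the component on the first generator. -/
noncomputable def firstComponent (hc : IsCoherent a ς) (hr : IsReliable a)
    (F : UBeta ⥤ ModuleCat.{u} K) :
    (translation 1).obj ((longMoody hc).obj F) ⟶ (translation 1).obj ((translation 1).obj F) where
  app X := ModuleCat.ofHom (firstComponentApp ς F X)
  naturality X Y φ := by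
    ext1
    refine AugTensor.hom_ext_of _ fun j v => ?_
    change firstComponentApp ς F Y (((longMoody hc).obj F).map ((UBeta.addLeft 1).map φ)
        (AugTensor.single (freeRep ς F (1 + X.strands)) (.of j) v)) =
      F.map ((UBeta.addLeft 1).map ((UBeta.addLeft 1).map φ)) (firstComponentApp ς F X
        (AugTensor.single (freeRep ς F (1 + X.strands)) (.of j) v))
    -- On the first generator naturality is reliability. The remaining generators lie in the image
    -- of LM(τ_1 F), which is preserved by morphisms and killed by the projection.
    rcases single_of_cases hc F X j v with rfl | ⟨s, w, hw⟩
    · rw [firstComponentApp_single_zero]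
      refine (congrArg _ (longMoody_obj_map_single hc F ((UBeta.addLeft 1).map φ) _ v)).trans ?_
      refine (congrArg (fun g => firstComponentApp ς F Y
        (AugTensor.single (freeRep ς F (1 + Y.strands)) g _))
        (freeAction_addLeft_of_zero hc hr φ)).trans ?_
      exact firstComponentApp_single_zero F Y _
    · rw [← hw, firstComponentApp_longMoodyTranslationApp, map_zero]
      refine Eq.trans (congrArg _ ?_) (firstComponentApp_longMoodyTranslationApp hc F Y
        (((longMoody hc).obj ((translation 1).obj F)).map φ
          (AugTensor.single (freeRep ς ((translation 1).obj F) X.strands) (.of s) w)))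
      exact (LinearMap.congr_fun (congrArg ModuleCat.Hom.hom
        ((longMoodyTranslation hc F).naturality φ))
        (AugTensor.single (freeRep ς ((translation 1).obj F) X.strands) (.of s) w)).symm

/-- Modulo the image of LM(τ_1 F), each element equals its first component placed back on the first
generator, as is checked on generators. -/
theorem exists_longMoodyTranslationApp_eq (hc : IsCoherent a ς) (F : UBeta ⥤ ModuleCat.{u} K)
    (X : UBeta) (z : AugTensor (freeRep ς F (1 + X.strands))) (hz : firstComponentApp ς F X z = 0) :
    ∃ y, longMoodyTranslationApp hc F X y = z := by
  let N := LinearMap.range (longMoodyTranslationApp hc F X)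
  have : N.mkQ = N.mkQ ∘ₗ AugTensor.single (freeRep ς F (1 + X.strands)) (.of ⟨0, by omega⟩) ∘ₗ
      firstComponentApp ς F X := by
    refine AugTensor.hom_ext_of _ fun j v => ?_
    rw [LinearMap.comp_apply, LinearMap.comp_apply]
    rcases single_of_cases hc F X j v with rfl | ⟨s, w, hw⟩
    · rw [firstComponentApp_single_zero]
    · rw [← hw, firstComponentApp_longMoodyTranslationApp, map_zero, map_zero]
      exact (Submodule.Quotient.mk_eq_zero N).mpr ⟨_, rfl⟩
  have h := LinearMap.congr_fun this z
  rw [LinearMap.comp_apply, LinearMap.comp_apply, hz, map_zero, map_zero] at h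
  exact (Submodule.Quotient.mk_eq_zero N).mp h

/-- The sequence `LM(δ_1 F) → δ_1 (LM F) → τ_1 (τ_1 F) → 0`. -/
theorem exists_isRightExact_difference_longMoody (hc : IsCoherent a ς) (hr : IsReliable a)
    (F : UBeta ⥤ ModuleCat.{u} K) :
    ∃ (f : (longMoody hc).obj (difference 1 F) ⟶ difference 1 ((longMoody hc).obj F))
      (g : difference 1 ((longMoody hc).obj F) ⟶ (translation 1).obj ((translation 1).obj F)),
      IsRightExact f g := by
  obtain ⟨f, hf⟩ := exists_desc_of_surjective ((longMoody hc).map (differenceProj 1 F))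
    (longMoodyTranslation hc F ≫ differenceProj 1 ((longMoody hc).obj F))
    (fun X => AugTensor.map_surjective _ _ _ (app_freeRep _ _) (differenceProj_surjective 1 F _))
    (fun X z hz => by
      -- By exactness the kernel of LM(τ_1 F) → LM(δ_1 F) is the image of LM(i_1), and the embedding
      -- sends this into the image of i_1, which dies in δ_1(LM F).
      obtain ⟨y, rfl⟩ : ∃ y, ((longMoody hc).map ((translationUnit 1).app F)).app X y = z :=
        AugTensor.exists_of_map_eq_zero _ _ _ _ _ (app_freeRep _ _) (app_freeRep _ _)
          (differenceProj_surjective 1 F _)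
          (isRightExact_differenceProj 1 F _).2 z hz
      exact (congrArg _ (longMoodyTranslation_app_map_translationUnit hc F X y)).trans
        (differenceProj_app_translationUnit 1 _ X y))
  obtain ⟨g, hg⟩ := exists_desc_difference (firstComponent hc hr F) (fun X z => by
    rw [← longMoodyTranslation_app_map_translationUnit]
    exact firstComponentApp_longMoodyTranslationApp hc F X _)
  refine ⟨f, g, fun X => ⟨surjective_app_of_comp (f := differenceProj 1 _) ?_, fun b hb => ?_⟩⟩
  · rw [hg]
    exact fun v => ⟨_, firstComponentApp_single_zero F X v⟩
  · obtain ⟨z, rfl⟩ := differenceProj_surjective 1 _ X b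
    have hz : firstComponentApp ς F X z = 0 :=
      (LinearMap.congr_fun (congrArg ModuleCat.Hom.hom (NatTrans.congr_app hg X)) z).symm.trans hb
    obtain ⟨y, rfl⟩ := exists_longMoodyTranslationApp_eq hc F X z hz
    exact ⟨((longMoody hc).map (differenceProj 1 F)).app X y,
      LinearMap.congr_fun (congrArg ModuleCat.Hom.hom (NatTrans.congr_app hf X)) y⟩

/-- The loss of one degree comes from the term τ_1 τ_1 F of the sequence, whose degree is only
bounded by that of F. -/
theorem IterDifferenceVanishes.longMoody (hc : IsCoherent a ς) (hr : IsReliable a) {d : ℕ}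
    {F : UBeta ⥤ ModuleCat.{u} K} (hF : IterDifferenceVanishes d F) :
    IterDifferenceVanishes (d + 1) ((longMoody hc).obj F) := by
  induction d generalizing F with
  | zero =>
    refine iterDifferenceVanishes_of_isZero (isZero_of_subsingleton_obj fun X => ?_)
    have := subsingleton_obj_of_isZero hF ⟨1 + X.strands⟩
    exact AugTensor.subsingleton _
  | succ d ih =>
    obtain ⟨f, g, h⟩ := exists_isRightExact_difference_longMoody hc hr F
    exact iterDifferenceVanishes_of_isRightExact (d := d + 1) h (ih hF)
      hF.translation.translation

/-- If `LM(F)` is polynomial of degree at most `m`, then `τ_2 F` is polynomial of degree at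
most `m - 1`. -/
theorem IterDifferenceVanishes.translation_two_of_longMoody (hc : IsCoherent a ς)
    (hr : IsReliable a) {m : ℕ} {F : UBeta ⥤ ModuleCat.{u} K}
    (h : IterDifferenceVanishes (m + 1) ((_root_.longMoody hc).obj F)) :
    IterDifferenceVanishes m ((_root_.translation 2).obj F) := by
  obtain ⟨f, g, hfg⟩ := exists_isRightExact_difference_longMoody hc hr F
  exact iterDifferenceVanishes_of_surjective (g ≫ (translationAssoc 1 F).hom)
    (fun X => surjective_app_comp (surjective_app_of_isIso _ X) (hfg X).1) h

end LongMoodyDifference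

theorem mainTheorem6 {K : Type u} [CommRing K]
    (a : ∀ n : ℕ, Braid n →* MulAut (FreeGroup (Fin n)))
    (ς : ∀ n : ℕ, FreeGroup (Fin n) →* Braid (1 + n))
    (hc : IsCoherent a ς) (hr : IsReliable a) (d : ℕ) (F : UBeta ⥤ ModuleCat.{u} K)
    (hF : IsStrongPolynomial d F) (hτ : HasStrongDegree d ((translation 2).obj F))
    (h0 : ¬ IsZero ((translation 2).obj F)) :
    HasStrongDegree (d + 1) ((longMoody hc).obj F) := by
  refine ⟨isStrongPolynomial_iff_iterDifferenceVanishes.mpr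
    ((isStrongPolynomial_iff_iterDifferenceVanishes.mp hF).longMoody hc hr), fun m hm => ?_⟩
  have h := (isStrongPolynomial_iff_iterDifferenceVanishes.mp hm).translation_two_of_longMoody hc hr
  cases m with
  -- If LM(F) had degree at most 0, then τ_2 F would be null. Degrees in ℕ do not distinguish null
  -- functors from those of degree 0, so this case needs the separate hypothesis.
  | zero => exact absurd h h0
  | succ m =>
    exact Nat.succ_le_succ (hτ.2 (isStrongPolynomial_iff_iterDifferenceVanishes.mpr h))
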